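/- Let $K\ge 2$, $p_1,\dots,p_K\in[0,1]$. For $p\in[0,1]$ and cluster sizes $n_1,\dots,n_K$ let $G$ be a random graph from the stochastic block model (SBM): $n=\sum_k n_k$ nodes partitioned into $K$ clusters, all edges independent, an edge inside cluster $k$ present with probability $p_k$ (so each cluster is an Erdős–Rényi graph) and an edge between different clusters present with probability $p$. Let $L$ and $L_k$ be the graph Laplacians of $G$ and of cluster $k$, let $$S_{2:K}(L)=\min\{\operatorname{tr}(X^TLX): X\in\mathbb R^{n\times(K-1)},\ X^TX=I,\ X^T\mathbf 1=0\}$$ (the sum of the second to the $K$-th smallest eigenvalues of $L$), let $Y$ denote a minimizer, and $Y_k$ its $n_k\times(K-1)$ block of rows belonging to cluster $k$. Consider a sequence of cluster sizes with $n_k\to\infty$ and $n_k/n\to\rho_k$ for all $k$, and $\min_k n_k/\max_k n_k\to c>0$. The graphs of different sizes for the same $p$ live on one probability space, with arbitrary joint law. Call $p^*\in[0,1]$ a critical value if the following hold: (a) for every $p\in[0,1]$ with $p\le p^*$, almost surely $S_{2:K}(L)/n\to(K-1)p$; and there is a constant $c^*$ such that, for every $p\in[0,1]$, almost surely $\frac1n\min_k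 S_{2:K}(L_k)\to c^*$ and, for every $p\in(p^*,1]$, almost surely $$c^*+(K-1)(1-\max_k\rho_k)p\le\liminf \tfrac{S_{2:K}(L)}{n}\le\limsup\tfrac{S_{2:K}(L)}{n}\le c^*+(K-1)(1-\min_k\rho_k)p;$$ (b) for every $p\in[0,p^*)$, almost surely, each column of $\sqrt{n_k}\,Y_k$ is asymptotically constant, for every $k$ (for constants $v^k_j$, which may vary along the sequence and with the choice of $Y$, $\frac1{n_k}\sum_i(\sqrt{n_k}[Y_k]_{ij}-v^k_j)^2\to0$ for every $j$, uniformly over the minimizers $Y$); and for every $p\in(p^*,1]$, almost surely, the centroid $\frac1{n_k}\sum_i\sqrt{n_k}[Y_k]_{ij}$, $j=1,\dots,K-1$, of the rows of $\sqrt{n_k}\,Y_k$ tends to $0$ for every $k$, uniformly over the minimizers $Y$. Then there is exactly one critical value $p^*$, and it satisfies $$c\cdot\min_{k}p_k\ \le\ p^*\ \le\ \frac1c\cdot\min_{k}p_k .$$ -/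

import Mathlib

open Filter Topology MeasureTheory ProbabilityTheory

noncomputable section

/-- The node set of a graph with `K` clusters, cluster `k` having `N k` nodes. -/
abbrev ClusterNode {K : ℕ} (N : Fin K → ℕ) : Type := Σ k : Fin K, Fin (N k)

/-- The graph Laplacian `L = D - A`. -/
def graphLaplacian {V : Type*} [Fintype V] [DecidableEq V] (G : SimpleGraph V) : Matrix V V ℝ :=
  haveI : DecidableRel G.Adj := Classical.decRel _
  G.lapMatrix ℝ

/-- The constraint set of spectral clustering with `r` columns: `Xᵀ X = I` and `Xᵀ 1 = 0`. -/
def spectralFeasible (V : Type*) [Fintype V] (r : ℕ) : Set (Matrix V (Fin r) ℝ) :=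
  {X | X.transpose * X = 1 ∧ X.transpose.mulVec (fun _ => 1) = 0}

/-- The optimal value `min tr (Xᵀ L X)` of the spectral clustering problem with `r` columns;
for `r = K - 1` this is the partial eigenvalue sum `S_{2:K}(L) = λ₂(L) + ⋯ + λ_K(L)`. -/
def partialEigSum {V : Type*} [Fintype V] (r : ℕ) (L : Matrix V V ℝ) : ℝ :=
  sInf ((fun X : Matrix V (Fin r) ℝ => (X.transpose * L * X).trace) '' spectralFeasible V r)

/-- `Y` solves the spectral clustering problem with `r` columns. -/
def IsSpectralSolution {V : Type*} [Fintype V] {r : ℕ} (L : Matrix V V ℝ)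
    (Y : Matrix V (Fin r) ℝ) : Prop :=
  Y ∈ spectralFeasible V r ∧
    ∀ X ∈ spectralFeasible V r, (Y.transpose * L * Y).trace ≤ (X.transpose * L * X).trace

/-- The graph formed by cluster `k` and its internal edges. -/
def clusterGraph {K : ℕ} {N : Fin K → ℕ} (G : SimpleGraph (ClusterNode N)) (k : Fin K) :
    SimpleGraph (Fin (N k)) :=
  G.comap (fun i => (⟨k, i⟩ : ClusterNode N))

/-- `G` is a random graph drawn from the stochastic block model with cluster sizes `N`: all edges
are independent; an edge inside cluster `k` is present with probability `pin k`, and an edge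
between two different clusters with probability `p`. -/
structure IsSBM {Ω : Type*} [MeasurableSpace Ω] (μ : Measure Ω) {K : ℕ} (N : Fin K → ℕ)
    (pin : Fin K → ℝ) (p : ℝ) (G : Ω → SimpleGraph (ClusterNode N)) : Prop where
  measurable_adj : ∀ u v, MeasurableSet {ω | (G ω).Adj u v}
  prob_adj : ∀ u v, u ≠ v →
    μ {ω | (G ω).Adj u v} = ENNReal.ofReal (if u.1 = v.1 then pin u.1 else p)
  indep_edges :
    iIndepSet (fun e : {e : Sym2 (ClusterNode N) // ¬ e.IsDiag} => {ω | e.1 ∈ (G ω).edgeSet}) μ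

/-- `q` is the critical value of spectral graph clustering, as a function of the inter-cluster
edge probability `p ∈ [0, 1]`. Here `G p N` is the random graph with inter-cluster edge
probability `p` and cluster sizes `N`, living on the probability space `(Ω p, μ p)`; the cluster
sizes run through the sequence `n m`, and `ρ k` is the limit of the relative size of cluster `k`. -/
structure IsCriticalValue {K : ℕ} {Ω : ℝ → Type*} [∀ p, MeasurableSpace (Ω p)]
    (μ : ∀ p, Measure (Ω p))
    (G : ∀ (p : ℝ) (N : Fin K → ℕ), Ω p → SimpleGraph (ClusterNode N))
    (n : ℕ → Fin K → ℕ) (ρ : Fin K → ℝ) (q : ℝ) : Prop where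
  mem_Icc : q ∈ Set.Icc (0 : ℝ) 1
  /-- For `p ≤ q`, almost surely `S_{2:K}(L) / n → (K - 1) p`. -/
  eigSum_of_le : ∀ p ∈ Set.Icc (0 : ℝ) 1, p ≤ q → ∀ᵐ ω ∂(μ p),
    Tendsto (fun m => partialEigSum (K - 1) (graphLaplacian (G p (n m) ω)) / ∑ k, (n m k : ℝ))
      atTop (𝓝 (((K : ℝ) - 1) * p))
  /-- There is a constant `c*`, the almost sure limit of `min_k S_{2:K}(L_k) / n`, such that for
  `p > q`, almost surely, asymptotically
  `c* + (K - 1) (1 - ρ_max) p ≤ S_{2:K}(L) / n ≤ c* + (K - 1) (1 - ρ_min) p`. -/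
  eigSum_of_gt : ∃ cStar : ℝ,
    (∀ p ∈ Set.Icc (0 : ℝ) 1, ∀ᵐ ω ∂(μ p),
      Tendsto (fun m =>
          (⨅ k, partialEigSum (K - 1) (graphLaplacian (clusterGraph (G p (n m) ω) k))) /
            ∑ k, (n m k : ℝ))
        atTop (𝓝 cStar)) ∧
    ∀ p ∈ Set.Icc (0 : ℝ) 1, q < p → ∀ᵐ ω ∂(μ p), ∀ ε : ℝ, 0 < ε → ∀ᶠ m in atTop,
      cStar + ((K : ℝ) - 1) * (1 - ⨆ k, ρ k) * p - ε
          ≤ partialEigSum (K - 1) (graphLaplacian (G p (n m) ω)) / ∑ k, (n m k : ℝ) ∧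
        partialEigSum (K - 1) (graphLaplacian (G p (n m) ω)) / ∑ k, (n m k : ℝ)
          ≤ cStar + ((K : ℝ) - 1) * (1 - ⨅ k, ρ k) * p + ε
  /-- For `p < q`, almost surely each column of `√n_k Y_k` is asymptotically constant on every
  cluster `k`: the mean square distance of its entries to a suitable constant tends to `0`. -/
  coherent_of_lt : ∀ p ∈ Set.Icc (0 : ℝ) 1, p < q → ∀ᵐ ω ∂(μ p), ∀ ε : ℝ, 0 < ε → ∀ᶠ m in atTop,
    ∀ Y : Matrix (ClusterNode (n m)) (Fin (K - 1)) ℝ,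
      IsSpectralSolution (graphLaplacian (G p (n m) ω)) Y →
      ∀ k, ∃ v : Fin (K - 1) → ℝ, ∀ j,
        (1 / (n m k : ℝ)) * ∑ i, (√(n m k : ℝ) * Y ⟨k, i⟩ j - v j) ^ 2 ≤ ε
  /-- For `p > q`, almost surely the centroid of the rows of `√n_k Y_k` tends to the origin, for
  every cluster `k`. -/
  incoherent_of_gt : ∀ p ∈ Set.Icc (0 : ℝ) 1, q < p → ∀ᵐ ω ∂(μ p), ∀ ε : ℝ, 0 < ε → ∀ᶠ m in atTop,
    ∀ Y : Matrix (ClusterNode (n m)) (Fin (K - 1)) ℝ,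
      IsSpectralSolution (graphLaplacian (G p (n m) ω)) Y →
      ∀ k j, |(1 / (n m k : ℝ)) * ∑ i, √(n m k : ℝ) * Y ⟨k, i⟩ j| ≤ ε

end

/-! The critical value is exactly `⨅ k, pin k`. The stated bounds then follow from `c ≤ 1`.

For `x` orthogonal to the constants, the expected Laplacian form is `p n ‖x‖² + ∑ n_k (p_k - p)
Var_k(x)`, where `Var_k` is the squared deviation from the mean on cluster `k`
(`weightedForm_blockWeight`). If `p ≤ min p_k`, no coefficient is negative and vectors constant on
clusters are optimal. If `p > min p_k`, the best choice puts all the mass, centred, on a cluster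
with the most negative coefficient. In both regimes orthonormal columns can attain the optimum
simultaneously, which gives the limit of the eigenvalue sum. A near-optimal solution must have small
variance on every cluster in the strict first regime, and small centroids in the second
(`clusterVar_solution_le`, `sq_clusterSum_solution_le`).

The random form is uniformly within `δ n ‖x‖²` of its expectation. Hoeffding's inequality and a
union bound control row sums and bilinear values on sign vectors; a four-cycle count turns the
latter into control of the quadratic form (`abs_weightedForm_le`). The failure probabilities are
summable over all size vectors, so Borel–Cantelli applies whatever the joint law.

Uniqueness holds because, for `p` strictly between two critical values, a solution would be both
nearly constant and nearly centred on each cluster, contradicting unit norm. -/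

/-! ### Laplacian forms, and the passage from sign vectors to all vectors. -/

/-- The quadratic form `½ ∑ P_ij (x_i - x_j)²` with edge weights `P`. -/
noncomputable def weightedForm {V : Type*} [Fintype V] (P : V → V → ℝ) (x : V → ℝ) : ℝ :=
  (∑ i, ∑ j, P i j * (x i - x j) ^ 2) / 2

open Classical in
/-- The `0`-`1` adjacency weights of a graph. -/
noncomputable def adjWeight {V : Type*} (G : SimpleGraph V) (i j : V) : ℝ :=
  if G.Adj i j then 1 else 0

lemma weightedForm_adjWeight_nonneg {V : Type*} [Fintype V] (G : SimpleGraph V) (x : V → ℝ) :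
    0 ≤ weightedForm (adjWeight G) x := by
  unfold weightedForm adjWeight
  refine div_nonneg (Finset.sum_nonneg fun i _ => Finset.sum_nonneg fun j _ => ?_) zero_le_two
  split_ifs <;> positivity

lemma trace_graphLaplacian {V : Type*} [Fintype V] [DecidableEq V] {r : ℕ} (G : SimpleGraph V)
    (X : Matrix V (Fin r) ℝ) :
    (X.transpose * graphLaplacian G * X).trace
      = ∑ j, weightedForm (adjWeight G) (fun i => X i j) := by
  classical
  unfold Matrix.trace
  refine Finset.sum_congr rfl fun j _ => ?_
  have h := @SimpleGraph.lapMatrix_toLinearMap₂' V ℝ _ G (Classical.decRel _) _ _ _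
    (fun i => X i j)
  rw [Matrix.toLinearMap₂'_apply'] at h
  have h2 : (X.transpose * graphLaplacian G * X).diag j
      = (fun i => X i j) ⬝ᵥ (graphLaplacian G).mulVec (fun i => X i j) := by
    rw [Matrix.diag_apply, Matrix.mul_assoc, Matrix.mul_apply]
    rfl
  rw [h2]
  unfold graphLaplacian
  rw [h]
  unfold weightedForm adjWeight
  congr 1
  refine Finset.sum_congr rfl fun i _ => Finset.sum_congr rfl fun j _ => ?_
  split_ifs <;> simp

lemma weightedForm_sub {V : Type*} [Fintype V] (P Q : V → V → ℝ) (x : V → ℝ) :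
    weightedForm (fun i j => P i j - Q i j) x = weightedForm P x - weightedForm Q x := by
  unfold weightedForm
  rw [← sub_div, ← Finset.sum_sub_distrib]
  simp_rw [← Finset.sum_sub_distrib, sub_mul]

lemma exists_sign_le {V : Type*} [Fintype V] (a u : V → ℝ) (hu : ∀ i, |u i| ≤ 1) :
    ∃ s : V → Bool, |∑ i, u i * a i| ≤ ∑ i, (if s i then 1 else -1) * a i := by
  refine ⟨fun i => decide (0 ≤ a i), (Finset.abs_sum_le_sum_abs _ _).trans ?_⟩
  refine Finset.sum_le_sum fun i _ => ?_
  rw [abs_mul]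
  have h1 : |u i| * |a i| ≤ |a i| := mul_le_of_le_one_left (abs_nonneg _) (hu i)
  by_cases h : 0 ≤ a i
  · simpa [h, abs_of_nonneg h] using h1
  · have h' : a i < 0 := not_le.1 h
    simpa [h, abs_of_neg h'] using h1

/-- A bilinear form on a product of cubes is extremal at vertices: fix one argument and maximize in
the other, twice. Only finitely many sign pairs then need probabilistic control. -/
lemma bilin_le_of_sign {V : Type*} [Fintype V] (M : V → V → ℝ) {C : ℝ}
    (h : ∀ s t : V → Bool,
      ∑ i, ∑ j, (if s i then 1 else -1) * (if t j then 1 else -1) * M i j ≤ C)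
    (u v : V → ℝ) (hu : ∀ i, |u i| ≤ 1) (hv : ∀ i, |v i| ≤ 1) :
    |∑ i, ∑ j, u i * v j * M i j| ≤ C := by
  obtain ⟨s, hs⟩ := exists_sign_le (fun i => ∑ j, v j * M i j) u hu
  obtain ⟨t, ht⟩ := exists_sign_le (fun j => ∑ i, (if s i then (1 : ℝ) else -1) * M i j) v hv
  calc |∑ i, ∑ j, u i * v j * M i j|
      = |∑ i, u i * ∑ j, v j * M i j| := by simp_rw [Finset.mul_sum, mul_assoc]
    _ ≤ ∑ i, (if s i then 1 else -1) * ∑ j, v j * M i j := hs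
    _ = ∑ j, v j * ∑ i, (if s i then 1 else -1) * M i j := by
        simp_rw [Finset.mul_sum]
        rw [Finset.sum_comm]
        refine Finset.sum_congr rfl fun i _ => Finset.sum_congr rfl fun j _ => by ring
    _ ≤ _ := (le_abs_self _).trans ht
    _ = ∑ i, ∑ j, (if s i then 1 else -1) * (if t j then 1 else -1) * M i j := by
        simp_rw [Finset.mul_sum]
        rw [Finset.sum_comm]
        refine Finset.sum_congr rfl fun i _ => Finset.sum_congr rfl fun j _ => by ring
    _ ≤ C := h s t

/-- The left side is a sum over closed walks of length four. Once `i` and `j` are fixed, the rest is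
the bilinear form evaluated at column `j` and row `i` of `M`, both with entries in `[-1, 1]`, so
each of the `card V ^ 2` pairs contributes at most `C`. -/
lemma sum_sq_gram_le {V : Type*} [Fintype V] (M : V → V → ℝ) {C : ℝ}
    (hM : ∀ i j, |M i j| ≤ 1)
    (h : ∀ u v : V → ℝ, (∀ i, |u i| ≤ 1) → (∀ i, |v i| ≤ 1) →
      |∑ i, ∑ j, u i * v j * M i j| ≤ C) :
    ∑ j, ∑ k, (∑ i, M i j * M i k) ^ 2 ≤ (Fintype.card V : ℝ) ^ 2 * C := by
  have hC : 0 ≤ C := (abs_nonneg _).trans (h 0 0 (by simp) (by simp))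
  have key : ∑ j, ∑ k, (∑ i, M i j * M i k) ^ 2
      = ∑ i, ∑ j, M i j * ∑ l, ∑ k, M l j * M i k * M l k := by
    have : ∀ j k, (∑ i, M i j * M i k) ^ 2
        = ∑ i, ∑ l, M i j * (M l j * M i k * M l k) := by
      intro j k
      rw [sq, Finset.sum_mul_sum]
      refine Finset.sum_congr rfl fun i _ => Finset.sum_congr rfl fun l _ => by ring
    simp_rw [this, Finset.mul_sum]
    calc _ = ∑ j, ∑ i, ∑ k, ∑ l, M i j * (M l j * M i k * M l k) :=
          Finset.sum_congr rfl fun j _ => Finset.sum_comm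
      _ = ∑ i, ∑ j, ∑ k, ∑ l, M i j * (M l j * M i k * M l k) := Finset.sum_comm
      _ = _ := Finset.sum_congr rfl fun i _ => Finset.sum_congr rfl fun j _ => Finset.sum_comm
  rw [key]
  calc _ ≤ ∑ _i : V, ∑ _j : V, C := by
        refine Finset.sum_le_sum fun i _ => Finset.sum_le_sum fun j _ => ?_
        refine (le_abs_self _).trans ?_
        rw [abs_mul]
        have := h (fun l => M l j) (fun k => M i k) (fun l => hM l j) (fun k => hM i k)
        nlinarith [hM i j, abs_nonneg (M i j)]
    _ = _ := by simp; ring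

/-- Cauchy–Schwarz twice: first to pass from `M` to its Gram matrix, then to bound the Gram form by
the Frobenius norm. -/
lemma quadForm_pow_four_le {V : Type*} [Fintype V] (M : V → V → ℝ) (x : V → ℝ) :
    (∑ i, ∑ j, x i * x j * M i j) ^ 4
      ≤ (∑ i, x i ^ 2) ^ 4 * ∑ j, ∑ k, (∑ i, M i j * M i k) ^ 2 := by
  have h1 : (∑ i, ∑ j, x i * x j * M i j) ^ 2
      ≤ (∑ i, x i ^ 2) * ∑ i, (∑ j, x j * M i j) ^ 2 := by
    have := Finset.sum_mul_sq_le_sq_mul_sq Finset.univ x (fun i => ∑ j, x j * M i j)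
    simpa only [Finset.mul_sum, ← mul_assoc] using this
  have h2 : ∑ i, (∑ j, x j * M i j) ^ 2
      = ∑ a : V × V, (x a.1 * x a.2) * ∑ i, M i a.1 * M i a.2 := by
    rw [Fintype.sum_prod_type]
    have : ∀ i, (∑ j, x j * M i j) ^ 2
        = ∑ j, ∑ k, x j * x k * (M i j * M i k) := by
      intro i
      rw [sq, Finset.sum_mul_sum]
      refine Finset.sum_congr rfl fun i _ => Finset.sum_congr rfl fun l _ => by ring
    simp_rw [this, Finset.mul_sum]
    rw [Finset.sum_comm]
    exact Finset.sum_congr rfl fun j _ => Finset.sum_comm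
  have h3 := Finset.sum_mul_sq_le_sq_mul_sq Finset.univ (fun a : V × V => x a.1 * x a.2)
    (fun a => ∑ i, M i a.1 * M i a.2)
  rw [← h2] at h3
  have h4 : ∑ a : V × V, (x a.1 * x a.2) ^ 2 = (∑ i, x i ^ 2) ^ 2 := by
    rw [Fintype.sum_prod_type, sq, Finset.sum_mul_sum]
    simp_rw [mul_pow]
  rw [h4, Fintype.sum_prod_type] at h3
  set q := ∑ i, x i ^ 2
  have hq : 0 ≤ q := Finset.sum_nonneg fun i _ => sq_nonneg _
  calc (∑ i, ∑ j, x i * x j * M i j) ^ 4 = ((∑ i, ∑ j, x i * x j * M i j) ^ 2) ^ 2 := by ring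
    _ ≤ (q * ∑ i, (∑ j, x j * M i j) ^ 2) ^ 2 := by gcongr
    _ = q ^ 2 * (∑ i, (∑ j, x j * M i j) ^ 2) ^ 2 := by ring
    _ ≤ q ^ 2 * (q ^ 2 * ∑ j, ∑ k, (∑ i, M i j * M i k) ^ 2) := by gcongr
    _ = _ := by ring

/-- Degree part minus adjacency part: the row sums control the first and the sign-vector bound
controls the second. -/
lemma weightedForm_eq_of_symm {V : Type*} [Fintype V] (M : V → V → ℝ)
    (hs : ∀ i j, M i j = M j i) (x : V → ℝ) :
    weightedForm M x = ∑ i, x i ^ 2 * ∑ j, M i j - ∑ i, ∑ j, x i * x j * M i j := by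
  have h1 : ∑ i, ∑ j, M i j * x j ^ 2 = ∑ i, ∑ j, M i j * x i ^ 2 := by
    rw [Finset.sum_comm]
    exact Finset.sum_congr rfl fun i _ => Finset.sum_congr rfl fun j _ => by rw [hs]
  have h2 : ∑ i, x i ^ 2 * ∑ j, M i j = ∑ i, ∑ j, M i j * x i ^ 2 := by
    simp_rw [Finset.mul_sum, mul_comm]
  have h3 : ∑ i, ∑ j, M i j * (x i - x j) ^ 2 = ∑ i, ∑ j, M i j * x i ^ 2
      + ∑ i, ∑ j, M i j * x j ^ 2 - 2 * ∑ i, ∑ j, x i * x j * M i j := by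
    simp_rw [Finset.mul_sum, ← Finset.sum_add_distrib, ← Finset.sum_sub_distrib]
    refine Finset.sum_congr rfl fun i _ => Finset.sum_congr rfl fun j _ => by ring
  unfold weightedForm
  rw [h3, h1, h2]
  ring

/-- A symmetric matrix with entries in `[-1, 1]`, small row sums and small values on sign vectors
has a small Laplacian form. -/
lemma abs_weightedForm_le {V : Type*} [Fintype V] (M : V → V → ℝ) (hs : ∀ i j, M i j = M j i)
    (hM : ∀ i j, |M i j| ≤ 1) {n η : ℝ} (hn : (Fintype.card V : ℝ) ≤ n) (hη : 0 ≤ η)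
    (hη1 : η ≤ 1) (hrow : ∀ i, |∑ j, M i j| ≤ η ^ 4 * n)
    (hsign : ∀ s t : V → Bool,
      ∑ i, ∑ j, (if s i then 1 else -1) * (if t j then 1 else -1) * M i j ≤ η ^ 4 * n ^ 2)
    (x : V → ℝ) :
    |weightedForm M x| ≤ 2 * η * n * ∑ i, x i ^ 2 := by
  set q := ∑ i, x i ^ 2 with hqdef
  have hq : 0 ≤ q := Finset.sum_nonneg fun i _ => sq_nonneg _
  have hc0 : (0 : ℝ) ≤ Fintype.card V := Nat.cast_nonneg _
  have hn0 : 0 ≤ n := hc0.trans hn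
  have h4 : η ^ 4 ≤ η := by
    calc η ^ 4 ≤ η ^ 1 := pow_le_pow_of_le_one hη hη1 (by norm_num)
      _ = η := pow_one η
  have hA : |∑ i, x i ^ 2 * ∑ j, M i j| ≤ η * n * q := by
    refine (Finset.abs_sum_le_sum_abs _ _).trans ?_
    rw [hqdef, Finset.mul_sum]
    refine Finset.sum_le_sum fun i _ => ?_
    rw [abs_mul, abs_of_nonneg (sq_nonneg _), mul_comm]
    have : η ^ 4 * n ≤ η * n := by gcongr
    gcongr
    exact (hrow i).trans this
  have hB : |∑ i, ∑ j, x i * x j * M i j| ≤ η * n * q := by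
    refine le_of_pow_le_pow_left₀ (n := 4) (by norm_num) (by positivity) ?_
    rw [show |∑ i, ∑ j, x i * x j * M i j| ^ 4 = (∑ i, ∑ j, x i * x j * M i j) ^ 4 from
      Even.pow_abs (by decide) _]
    refine (quadForm_pow_four_le M x).trans ?_
    have hg := sum_sq_gram_le M hM (bilin_le_of_sign M hsign)
    calc q ^ 4 * ∑ j, ∑ k, (∑ i, M i j * M i k) ^ 2
        ≤ q ^ 4 * ((Fintype.card V : ℝ) ^ 2 * (η ^ 4 * n ^ 2)) := by gcongr
      _ ≤ q ^ 4 * (n ^ 2 * (η ^ 4 * n ^ 2)) := by gcongr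
      _ = _ := by ring
  rw [weightedForm_eq_of_symm M hs]
  calc _ ≤ |∑ i, x i ^ 2 * ∑ j, M i j| + |∑ i, ∑ j, x i * x j * M i j| := abs_sub _ _
    _ ≤ _ := by linarith

/-! ### Hoeffding bounds for the edges of a random graph. -/

section EdgeConcentration

variable {Ω : Type*} [MeasurableSpace Ω] {μ : Measure Ω} {V : Type*}

/-- The centred indicator of the edge `e` of a random graph. -/
noncomputable def edgeDev (μ : Measure Ω) (H : Ω → SimpleGraph V)
    (e : {e : Sym2 V // ¬ e.IsDiag}) (ω : Ω) : ℝ :=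
  {ω | e.1 ∈ (H ω).edgeSet}.indicator (fun _ => (1 : ℝ)) ω - μ.real {ω | e.1 ∈ (H ω).edgeSet}

/-- The deviation of the adjacency weights of a random graph from their expectation. -/
noncomputable def adjDev (μ : Measure Ω) (H : Ω → SimpleGraph V) (ω : Ω) (i j : V) : ℝ :=
  adjWeight (H ω) i j - μ.real {ω | (H ω).Adj i j}

lemma adjDev_symm (H : Ω → SimpleGraph V) (ω : Ω) (i j : V) :
    adjDev μ H ω i j = adjDev μ H ω j i := by
  have h : ∀ ω, (H ω).Adj i j ↔ (H ω).Adj j i := fun ω => (H ω).adj_comm i j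
  unfold adjDev adjWeight
  congr 1
  · by_cases hij : (H ω).Adj i j
    · rw [if_pos hij, if_pos ((h ω).1 hij)]
    · rw [if_neg hij, if_neg (mt (h ω).2 hij)]
  · simp only [h]

lemma adjDev_self (H : Ω → SimpleGraph V) (ω : Ω) (i : V) : adjDev μ H ω i i = 0 := by
  simp [adjDev, adjWeight]

lemma abs_adjDev_le [IsProbabilityMeasure μ] (H : Ω → SimpleGraph V) (ω : Ω) (i j : V) :
    |adjDev μ H ω i j| ≤ 1 := by
  unfold adjDev adjWeight
  have h0 : 0 ≤ μ.real {ω | (H ω).Adj i j} := measureReal_nonneg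
  have h1 : μ.real {ω | (H ω).Adj i j} ≤ 1 := measureReal_le_one
  rw [abs_le]
  split_ifs <;> constructor <;> linarith

lemma adjDev_eq_edgeDev (H : Ω → SimpleGraph V) (ω : Ω) {i j : V} (h : ¬ s(i, j).IsDiag) :
    adjDev μ H ω i j = edgeDev μ H ⟨s(i, j), h⟩ ω := by
  classical
  simp only [adjDev, edgeDev, adjWeight, SimpleGraph.mem_edgeSet, Set.indicator_apply,
    Set.mem_ofPred_eq]

lemma measurableSet_mem_edgeSet {H : Ω → SimpleGraph V}
    (hm : ∀ u v, MeasurableSet {ω | (H ω).Adj u v}) (e : Sym2 V) :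
    MeasurableSet {ω | e ∈ (H ω).edgeSet} := by
  induction e with
  | _ u v => simpa using hm u v

lemma hasSubgaussianMGF_edgeDev [IsProbabilityMeasure μ] {H : Ω → SimpleGraph V}
    (hm : ∀ u v, MeasurableSet {ω | (H ω).Adj u v}) (e : {e : Sym2 V // ¬ e.IsDiag}) :
    HasSubgaussianMGF (edgeDev μ H e) (1 / 4) μ := by
  have hs := measurableSet_mem_edgeSet hm e.1
  have h := hasSubgaussianMGF_of_mem_Icc (μ := μ) (a := 0) (b := 1)
    (X := {ω | e.1 ∈ (H ω).edgeSet}.indicator (fun _ => (1 : ℝ)))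
    (measurable_const.indicator hs).aemeasurable
    (ae_of_all _ fun ω => by
      classical
      rw [Set.indicator_apply]; split_ifs <;> simp)
  rw [integral_indicator_const _ hs] at h
  have hc : ((‖(1 : ℝ) - 0‖₊ / 2) ^ 2 : NNReal) = 1 / 4 := by
    rw [sub_zero, nnnorm_one, div_pow]; norm_num
  rw [hc] at h
  simp only [smul_eq_mul, mul_one] at h
  exact h

variable [Fintype V] [DecidableEq V]

/-- The total weight that the ordered pair weights `f` put on the edge `e`. -/
noncomputable def edgeCoeff (f : V × V → ℝ) (e : {e : Sym2 V // ¬ e.IsDiag}) : ℝ :=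
  ∑ a : V × V, if s(a.1, a.2) = e.1 then f a else 0

lemma sum_edge_ite (a : V × V) (y : {e : Sym2 V // ¬ e.IsDiag} → ℝ) :
    (∑ e : {e : Sym2 V // ¬ e.IsDiag}, if s(a.1, a.2) = e.1 then y e else 0)
      = if h : ¬ s(a.1, a.2).IsDiag then y ⟨s(a.1, a.2), h⟩ else 0 := by
  split_ifs with h
  · exact Finset.sum_eq_zero fun e _ => if_neg fun h' : s(a.1, a.2) = e.1 => e.2 (h' ▸ h)
  · rw [Finset.sum_eq_single ⟨s(a.1, a.2), h⟩]
    · simp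
    · intro e _ he
      exact if_neg fun h' => he (Subtype.ext h'.symm)
    · simp

/-- The pairs `(i, j)` and `(j, i)` carry the same random variable, so they are merged into one
unordered edge to obtain a sum of independent terms. -/
lemma sum_mul_adjDev (H : Ω → SimpleGraph V) (ω : Ω) (f : V × V → ℝ) :
    ∑ a : V × V, f a * adjDev μ H ω a.1 a.2 = ∑ e, edgeCoeff f e * edgeDev μ H e ω := by
  unfold edgeCoeff
  simp_rw [Finset.sum_mul]
  rw [Finset.sum_comm]
  refine Finset.sum_congr rfl fun a _ => ?_
  simp_rw [ite_mul, zero_mul]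
  rw [sum_edge_ite a (fun e => f a * edgeDev μ H e ω)]
  split_ifs with h
  · have : a.1 = a.2 := by simpa using h
    rw [this, adjDev_self, mul_zero]
  · rw [adjDev_eq_edgeDev H ω h]

/-- An edge collects at most two ordered pairs, so its coefficient has absolute value at most 2 and
its square is at most twice its absolute value. -/
lemma sum_sq_edgeCoeff_le (f : V × V → ℝ) (hf : ∀ a, |f a| ≤ 1) :
    ∑ e, edgeCoeff f e ^ 2 ≤ 2 * ∑ a, |f a| := by
  have h1 : ∀ e, |edgeCoeff f e| ≤ ∑ a : V × V, if s(a.1, a.2) = e.1 then |f a| else 0 := by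
    intro e
    refine (Finset.abs_sum_le_sum_abs _ _).trans (Finset.sum_le_sum fun a _ => ?_)
    split_ifs <;> simp
  have h2 : ∀ e, |edgeCoeff f e| ≤ 2 := by
    intro e
    refine (h1 e).trans ?_
    obtain ⟨e, he⟩ := e
    induction e with
    | _ u v =>
    rw [← Finset.sum_filter]
    have hsub : (Finset.univ.filter fun a : V × V => s(a.1, a.2) = s(u, v)) ⊆ {(u, v), (v, u)} := by
      rintro ⟨a, b⟩ h
      simpa using h
    calc _ ≤ ∑ a ∈ ({(u, v), (v, u)} : Finset (V × V)), |f a| :=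
          Finset.sum_le_sum_of_subset_of_nonneg hsub fun _ _ _ => abs_nonneg _
      _ ≤ ∑ a ∈ ({(u, v), (v, u)} : Finset (V × V)), (1 : ℝ) :=
          Finset.sum_le_sum fun a _ => hf a
      _ ≤ 2 := by
          rw [Finset.sum_const, nsmul_eq_mul, mul_one]
          exact_mod_cast Finset.card_le_two
  calc ∑ e, edgeCoeff f e ^ 2
      ≤ ∑ e : {e : Sym2 V // ¬ e.IsDiag},
          2 * ∑ a : V × V, if s(a.1, a.2) = e.1 then |f a| else 0 := by
        refine Finset.sum_le_sum fun e _ => ?_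
        rw [← sq_abs]
        nlinarith [h1 e, h2 e, abs_nonneg (edgeCoeff f e)]
    _ = 2 * ∑ a : V × V, ∑ e : {e : Sym2 V // ¬ e.IsDiag},
          if s(a.1, a.2) = e.1 then |f a| else 0 := by
        rw [← Finset.mul_sum, Finset.sum_comm]
    _ ≤ 2 * ∑ a, |f a| := by
        gcongr with a
        rw [sum_edge_ite a (fun _ => |f a|)]
        split_ifs <;> simp

/-- Hoeffding's inequality for a weighted count of the edges of a random graph. -/
lemma measure_le_sum_adjDev [IsProbabilityMeasure μ] {H : Ω → SimpleGraph V}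
    (hm : ∀ u v, MeasurableSet {ω | (H ω).Adj u v})
    (hi : iIndepSet (fun e : {e : Sym2 V // ¬ e.IsDiag} => {ω | e.1 ∈ (H ω).edgeSet}) μ)
    (f : V × V → ℝ) (hf : ∀ a, |f a| ≤ 1) {F t : ℝ} (hF : ∑ a, |f a| ≤ F) (ht : 0 ≤ t) :
    μ {ω | t ≤ ∑ a : V × V, f a * adjDev μ H ω a.1 a.2}
      ≤ ENNReal.ofReal (Real.exp (-t ^ 2 / F)) := by
  have hF0 : 0 ≤ F := (Finset.sum_nonneg fun _ _ => abs_nonneg _).trans hF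
  have hind : iIndepFun (fun e ω => edgeCoeff f e * edgeDev μ H e ω) μ := by
    have h := hi.iIndepFun_indicator (β := ℝ) (m := inferInstance)
    refine h.comp (fun e x => edgeCoeff f e * (x - μ.real {ω | e.1 ∈ (H ω).edgeSet})) ?_
    intro e
    fun_prop
  have hsum := HasSubgaussianMGF.sum_of_iIndepFun hind (s := Finset.univ)
    (fun e _ => (hasSubgaussianMGF_edgeDev hm e).const_mul (edgeCoeff f e))
  -- Each edge has variance proxy `1/4`, so the exact total is at most `F / 2`; enlarging it to `F /
  -- 2` yields the exponent `-t² / F`.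
  have hmono : HasSubgaussianMGF (fun ω => ∑ e, edgeCoeff f e * edgeDev μ H e ω)
      ⟨F / 2, by positivity⟩ μ := by
    refine ⟨hsum.1, fun t => (hsum.2 t).trans ?_⟩
    have : ∑ e, edgeCoeff f e ^ 2 * (1 / 4) ≤ F / 2 := by
      rw [← Finset.sum_mul]
      linarith [sum_sq_edgeCoeff_le f hf]
    rw [Real.exp_le_exp]
    push_cast
    change (∑ e, edgeCoeff f e ^ 2 * (1 / 4)) * t ^ 2 / 2 ≤ F / 2 * t ^ 2 / 2
    gcongr
  have h := hmono.measure_ge_le ht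
  simp_rw [sum_mul_adjDev]
  rw [← ofReal_measureReal]
  refine ENNReal.ofReal_le_ofReal (h.trans (le_of_eq ?_))
  change Real.exp (-t ^ 2 / (2 * (F / 2))) = _
  rw [mul_div_cancel₀ _ (two_ne_zero)]

/-- Union bound over the signed rows and over at most `4 ^ n` pairs of sign vectors. The thresholds
`η ^ 4 * n` and `η ^ 4 * n ^ 2`, against total weights at most `n` and `n ^ 2`, produce the two
exponents; the second is quadratic in `n` and beats `4 ^ n`. -/
lemma measure_abs_weightedForm_gt_le [IsProbabilityMeasure μ] {H : Ω → SimpleGraph V}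
    (hm : ∀ u v, MeasurableSet {ω | (H ω).Adj u v})
    (hi : iIndepSet (fun e : {e : Sym2 V // ¬ e.IsDiag} => {ω | e.1 ∈ (H ω).edgeSet}) μ)
    {n : ℕ} (hn : Fintype.card V ≤ n) (hn0 : 0 < n) {η : ℝ} (hη : 0 ≤ η) (hη1 : η ≤ 1) :
    μ {ω | ¬ ∀ x : V → ℝ, |weightedForm (adjDev μ H ω) x| ≤ 2 * η * n * ∑ i, x i ^ 2}
      ≤ ENNReal.ofReal (2 * n * Real.exp (-η ^ 8 * n) + 4 ^ n * Real.exp (-η ^ 8 * n ^ 2)) := by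
  have hnR : (0 : ℝ) < n := by exact_mod_cast hn0
  have hcard : (Fintype.card V : ℝ) ≤ n := by exact_mod_cast hn
  let sgn : Bool → ℝ := fun b => if b then 1 else -1
  have hsgn : ∀ b, |sgn b| = 1 := by intro b; cases b <;> simp [sgn]
  let f : Bool → V → V × V → ℝ := fun b i a => if a.1 = i then sgn b else 0
  let g : (V → Bool) × (V → Bool) → V × V → ℝ := fun st a => sgn (st.1 a.1) * sgn (st.2 a.2)
  let A : Bool × V → Set Ω := fun bi =>
    {ω | η ^ 4 * n ≤ ∑ a : V × V, f bi.1 bi.2 a * adjDev μ H ω a.1 a.2}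
  let B : (V → Bool) × (V → Bool) → Set Ω := fun st =>
    {ω | η ^ 4 * n ^ 2 ≤ ∑ a : V × V, g st a * adjDev μ H ω a.1 a.2}
  have hA : ∀ bi, μ (A bi) ≤ ENNReal.ofReal (Real.exp (-η ^ 8 * n)) := by
    intro bi
    refine (measure_le_sum_adjDev hm hi (f bi.1 bi.2) ?_ (F := n) ?_ (by positivity)).trans
      (le_of_eq ?_)
    · intro a
      simp only [f]
      split_ifs <;> simp [hsgn]
    · rw [Fintype.sum_prod_type]
      simp only [f]
      rw [Finset.sum_eq_single bi.2]
      · simpa [hsgn] using hcard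
      · intro b _ hb
        simp [hb]
      · simp
    · congr 2
      field_simp
  have hB : ∀ st, μ (B st) ≤ ENNReal.ofReal (Real.exp (-η ^ 8 * n ^ 2)) := by
    intro st
    refine (measure_le_sum_adjDev hm hi (g st) ?_ (F := n ^ 2) ?_ (by positivity)).trans
      (le_of_eq ?_)
    · intro a
      simp [g, abs_mul, hsgn]
    · simp only [g, abs_mul, hsgn]
      simp only [mul_one, Finset.sum_const, Finset.card_univ, Fintype.card_prod, nsmul_eq_mul]
      push_cast
      rw [sq]
      gcongr
    · congr 2
      field_simp
  have hsub : {ω | ¬ ∀ x : V → ℝ, |weightedForm (adjDev μ H ω) x| ≤ 2 * η * n * ∑ i, x i ^ 2}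
      ⊆ (⋃ bi, A bi) ∪ ⋃ st, B st := by
    intro ω hω
    by_contra hcon
    simp only [Set.mem_union, Set.mem_iUnion, not_or, not_exists] at hcon
    obtain ⟨h1, h2⟩ := hcon
    refine hω (abs_weightedForm_le _ (adjDev_symm H ω) (abs_adjDev_le H ω) hcard hη hη1 ?_ ?_)
    · intro i
      have hrow : ∀ b, ∑ a : V × V, f b i a * adjDev μ H ω a.1 a.2
          = sgn b * ∑ j, adjDev μ H ω i j := by
        intro b
        rw [Fintype.sum_prod_type]
        simp only [f]
        rw [Finset.sum_eq_single i]
        · simp [Finset.mul_sum]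
        · intro b _ hb
          simp [hb]
        · simp
      have ht := h1 (true, i)
      have hf := h1 (false, i)
      simp only [A, Set.mem_ofPred_eq, not_le, hrow, sgn] at ht hf
      rw [abs_le]
      constructor
      · norm_num at hf; linarith
      · norm_num at ht; linarith
    · intro s t
      have := h2 (s, t)
      simp only [B, Set.mem_ofPred_eq, not_le, g, Fintype.sum_prod_type] at this
      exact this.le
  calc _ ≤ μ ((⋃ bi, A bi) ∪ ⋃ st, B st) := measure_mono hsub
    _ ≤ ∑ bi, μ (A bi) + ∑ st, μ (B st) :=
        (measure_union_le _ _).trans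
          (add_le_add (measure_iUnion_fintype_le _ _) (measure_iUnion_fintype_le _ _))
    _ ≤ ∑ _bi : Bool × V, ENNReal.ofReal (Real.exp (-η ^ 8 * n))
          + ∑ _st : (V → Bool) × (V → Bool), ENNReal.ofReal (Real.exp (-η ^ 8 * n ^ 2)) :=
        add_le_add (Finset.sum_le_sum fun _ _ => hA _) (Finset.sum_le_sum fun _ _ => hB _)
    _ = ENNReal.ofReal ((2 * Fintype.card V : ℕ) * Real.exp (-η ^ 8 * n)
          + (2 ^ Fintype.card V * 2 ^ Fintype.card V : ℕ) * Real.exp (-η ^ 8 * n ^ 2)) := by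
        rw [ENNReal.ofReal_add (by positivity) (by positivity), ENNReal.ofReal_mul (by positivity),
          ENNReal.ofReal_mul (by positivity), ENNReal.ofReal_natCast, ENNReal.ofReal_natCast]
        simp
    _ ≤ _ := by
        apply ENNReal.ofReal_le_ofReal
        rw [← pow_add, ← two_mul, pow_mul]
        push_cast
        have : (2 ^ 2 : ℝ) ^ Fintype.card V ≤ 4 ^ n := by
          rw [show (2 ^ 2 : ℝ) = 4 by norm_num]
          exact pow_le_pow_right₀ (by norm_num) hn
        gcongr
        norm_num

end EdgeConcentration

/-! ### Summability over size vectors and Borel–Cantelli. -/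

lemma exists_exp_bound {ε : ℝ} (hε : 0 < ε) :
    ∃ C a : ℝ, 1 ≤ C ∧ 0 < a ∧ ∀ n : ℕ,
      2 * n * Real.exp (-ε * n) + 4 ^ n * Real.exp (-ε * n ^ 2) ≤ C * Real.exp (-a * n) := by
  -- Half of the first exponent absorbs the factor `n`. For the second term, `4 ^ n ≤ exp (2 n)`,
  -- and `(2 + ε/2)² / (4ε)` is the maximum of `(2 + ε/2) n - ε n²` over real `n`.
  refine ⟨4 / ε + Real.exp ((2 + ε / 2) ^ 2 / (4 * ε)), ε / 2, ?_, by positivity, fun n => ?_⟩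
  · have : 1 ≤ Real.exp ((2 + ε / 2) ^ 2 / (4 * ε)) := Real.one_le_exp (by positivity)
    have : 0 < 4 / ε := by positivity
    linarith
  rw [add_mul]
  refine add_le_add ?_ ?_
  · have h1 : (ε / 2) * n ≤ Real.exp ((ε / 2) * n) := by
      linarith [Real.add_one_le_exp ((ε / 2) * n)]
    have h2 : Real.exp (-ε * n) = Real.exp (-(ε / 2) * n) * Real.exp (-(ε / 2) * n) := by
      rw [← Real.exp_add]; congr 1; ring
    have h3 : Real.exp ((ε / 2) * n) * Real.exp (-(ε / 2) * n) = 1 := by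
      rw [← Real.exp_add]; simp
    have h4 : (ε / 2) * n * Real.exp (-(ε / 2) * n) ≤ 1 := by
      rw [← h3]; gcongr
    calc 2 * n * Real.exp (-ε * n)
        = 4 / ε * ((ε / 2) * n * Real.exp (-(ε / 2) * n)) * Real.exp (-(ε / 2) * n) := by
          rw [h2]; field_simp; ring
      _ ≤ 4 / ε * 1 * Real.exp (-(ε / 2) * n) := by gcongr
      _ = _ := by ring
  · have h4 : (4 : ℝ) ^ n ≤ Real.exp (2 * n) := by
      rw [mul_comm, Real.exp_nat_mul]
      gcongr
      have : (2 : ℝ) ≤ Real.exp 1 := by linarith [Real.add_one_le_exp (1 : ℝ)]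
      have h : Real.exp 2 = Real.exp 1 * Real.exp 1 := by rw [← Real.exp_add]; norm_num
      rw [h]; nlinarith
    calc (4 : ℝ) ^ n * Real.exp (-ε * n ^ 2) ≤ Real.exp (2 * n) * Real.exp (-ε * n ^ 2) := by
          gcongr
      _ = Real.exp (2 * n - ε * n ^ 2) := by rw [← Real.exp_add]; congr 1; ring
      _ ≤ Real.exp ((2 + ε / 2) ^ 2 / (4 * ε) + -(ε / 2) * n) := by
          rw [Real.exp_le_exp]
          have : (2 + ε / 2) ^ 2 / (4 * ε) + -(ε / 2) * n - (2 * n - ε * n ^ 2)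
              = (2 + ε / 2 - 2 * ε * n) ^ 2 / (4 * ε) := by field_simp; ring
          have h0 : 0 ≤ (2 + ε / 2 - 2 * ε * n) ^ 2 / (4 * ε) := by positivity
          linarith
      _ = _ := by rw [Real.exp_add]

lemma tsum_pi_prod (f : ℕ → ENNReal) (K : ℕ) :
    ∑' N : Fin K → ℕ, ∏ k, f (N k) = (∑' n, f n) ^ K := by
  induction K with
  | zero => simp [tsum_fintype]
  | succ K ih =>
    rw [← (Fin.consEquiv fun _ => ℕ).tsum_eq, ENNReal.tsum_prod']
    simp [Fin.prod_univ_succ, Fin.consEquiv, ENNReal.tsum_mul_left, ENNReal.tsum_mul_right, ih, pow_succ']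

/-- The exponential of the total size factors over the clusters, so the series is a multiple of the
`K`-th power of a geometric series. -/
lemma tsum_exp_neg_sum_ne_top {K : ℕ} (C : ℝ) {a : ℝ} (ha : 0 < a) :
    ∑' N : Fin K → ℕ, ENNReal.ofReal (C * Real.exp (-a * (∑ k, N k : ℕ))) ≠ ⊤ := by
  have h : ∀ N : Fin K → ℕ, ENNReal.ofReal (C * Real.exp (-a * (∑ k, N k : ℕ)))
      = ENNReal.ofReal C * ∏ k, ENNReal.ofReal (Real.exp (-a)) ^ N k := by
    intro N
    rw [ENNReal.ofReal_mul' (Real.exp_pos _).le, Finset.prod_pow_eq_pow_sum,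
      ← ENNReal.ofReal_pow (Real.exp_pos _).le, ← Real.exp_nat_mul, mul_comm (-a)]
  simp_rw [h]
  rw [ENNReal.tsum_mul_left, tsum_pi_prod, ENNReal.tsum_geometric]
  refine ENNReal.mul_ne_top ENNReal.ofReal_ne_top (ENNReal.pow_ne_top ?_)
  rw [ENNReal.inv_ne_top]
  refine (tsub_pos_of_lt ?_).ne'
  rw [← ENNReal.ofReal_one]
  exact (ENNReal.ofReal_lt_ofReal_iff one_pos).2 (by simpa using ha)

/-- Borel–Cantelli for events indexed by the vector of cluster sizes. -/
lemma ae_eventually_notMem_of_sizes {Ω : Type*} [MeasurableSpace Ω] {μ : Measure Ω} {K : ℕ}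
    (hK : 0 < K) {n : ℕ → Fin K → ℕ} (hn : ∀ k, Tendsto (fun m => n m k) atTop atTop)
    {bad : (Fin K → ℕ) → Set Ω} {C a : ℝ} (ha : 0 < a)
    (hb : ∀ N, μ (bad N) ≤ ENNReal.ofReal (C * Real.exp (-a * (∑ k, N k : ℕ)))) :
    ∀ᵐ ω ∂μ, ∀ᶠ m in atTop, ω ∉ bad (n m) := by
  -- The sum runs over all size vectors, not over `m`: the sizes may grow arbitrarily slowly and
  -- repeat, so the probabilities along the sequence need not be summable. Almost surely only
  -- finitely many vectors are bad, and one coordinate tending to infinity suffices to leave them.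
  have hfin : ∑' N, μ (bad N) ≠ ⊤ :=
    ne_top_of_le_ne_top (tsum_exp_neg_sum_ne_top C ha) (ENNReal.tsum_le_tsum hb)
  filter_upwards [ae_finite_setOfPred_mem hfin] with ω hω
  have h := (hω.image (fun N => N ⟨0, hK⟩)).compl_mem_cofinite
  rw [Nat.cofinite_eq_atTop] at h
  filter_upwards [(hn ⟨0, hK⟩).eventually h] with m hm hmem
  exact hm ⟨n m, hmem, rfl⟩

/-! ### The expected form of the block model. -/

lemma weightedForm_one {V : Type*} [Fintype V] (x : V → ℝ) :
    weightedForm (fun _ _ => 1) x = Fintype.card V * ∑ i, x i ^ 2 - (∑ i, x i) ^ 2 := by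
  unfold weightedForm
  have h : ∀ i j, (1 : ℝ) * (x i - x j) ^ 2 = x i ^ 2 + x j ^ 2 - 2 * (x i * x j) :=
    fun i j => by ring
  simp_rw [h, Finset.sum_sub_distrib, Finset.sum_add_distrib, ← Finset.mul_sum]
  rw [← Finset.sum_mul, sq (∑ i, x i)]
  simp [← Finset.mul_sum]
  ring

lemma weightedForm_const {V : Type*} [Fintype V] (a : ℝ) (x : V → ℝ) :
    weightedForm (fun _ _ => a) x = a * (Fintype.card V * ∑ i, x i ^ 2 - (∑ i, x i) ^ 2) := by
  rw [← weightedForm_one]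
  unfold weightedForm
  simp_rw [one_mul, ← Finset.mul_sum]
  ring

lemma weightedForm_congr {V : Type*} [Fintype V] {P Q : V → V → ℝ}
    (h : ∀ i j, i ≠ j → P i j = Q i j) (x : V → ℝ) : weightedForm P x = weightedForm Q x := by
  unfold weightedForm
  congr 1
  refine Finset.sum_congr rfl fun i _ => Finset.sum_congr rfl fun j _ => ?_
  rcases eq_or_ne i j with rfl | hij
  · simp
  · rw [h i j hij]

/-- The edge probabilities of the stochastic block model. -/
noncomputable def blockWeight {K : ℕ} (N : Fin K → ℕ) (pin : Fin K → ℝ) (p : ℝ)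
    (u v : ClusterNode N) : ℝ :=
  if u.1 = v.1 then pin u.1 else p

/-- The sum of squared deviations of the entries of `x` on cluster `k` from their mean. -/
noncomputable def clusterVar {K : ℕ} {N : Fin K → ℕ} (x : ClusterNode N → ℝ) (k : Fin K) : ℝ :=
  ∑ i, x ⟨k, i⟩ ^ 2 - (∑ i, x ⟨k, i⟩) ^ 2 / N k

lemma clusterVar_nonneg {K : ℕ} {N : Fin K → ℕ} (x : ClusterNode N → ℝ) (k : Fin K) :
    0 ≤ clusterVar x k := by
  unfold clusterVar
  have h := sq_sum_le_card_mul_sum_sq (s := Finset.univ) (f := fun i : Fin (N k) => x ⟨k, i⟩)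
  rw [Finset.card_univ, Fintype.card_fin] at h
  rw [sub_nonneg]
  exact div_le_of_le_mul₀ (Nat.cast_nonneg _) (Finset.sum_nonneg fun _ _ => sq_nonneg _)
    (by rwa [mul_comm])

lemma sum_clusterVar {K : ℕ} {N : Fin K → ℕ} (x : ClusterNode N → ℝ) :
    ∑ k, clusterVar x k = ∑ u, x u ^ 2 - ∑ k, (∑ i, x ⟨k, i⟩) ^ 2 / N k := by
  unfold clusterVar
  rw [Finset.sum_sub_distrib, Fintype.sum_sigma]

/-- The weights are the constant `p` plus a correction `pin k - p` inside cluster `k`. Each piece is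
a weighted complete graph, whose form is explicit; zero sum of `x` removes the mean term of the
constant piece. -/
lemma weightedForm_blockWeight {K : ℕ} {N : Fin K → ℕ} (hN : ∀ k, 0 < N k) (pin : Fin K → ℝ)
    (p : ℝ) (x : ClusterNode N → ℝ) (hx : ∑ u, x u = 0) :
    weightedForm (blockWeight N pin p) x
      = p * (∑ k, (N k : ℝ)) * ∑ u, x u ^ 2
        + ∑ k, N k * (pin k - p) * clusterVar x k := by
  have hsplit : weightedForm (blockWeight N pin p) x = weightedForm (fun _ _ => p) x
      + ∑ k, weightedForm (fun _ _ => pin k - p) (fun i => x ⟨k, i⟩) := by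
    unfold weightedForm
    rw [← Finset.sum_div, ← add_div]
    congr 1
    have h1 : ∀ u v : ClusterNode N, blockWeight N pin p u v * (x u - x v) ^ 2
        = p * (x u - x v) ^ 2 + if u.1 = v.1 then (pin u.1 - p) * (x u - x v) ^ 2 else 0 := by
      intro u v
      unfold blockWeight
      split_ifs <;> ring
    simp_rw [h1, Finset.sum_add_distrib]
    congr 1
    rw [Fintype.sum_sigma]
    refine Finset.sum_congr rfl fun k _ => Finset.sum_congr rfl fun i _ => ?_
    rw [Fintype.sum_sigma, Finset.sum_eq_single k]
    · simp
    · intro l _ hl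
      simp [hl.symm]
    · simp
  rw [hsplit, weightedForm_const, hx]
  simp_rw [weightedForm_const]
  congr 1
  · simp [Fintype.card_sigma]
    ring
  · refine Finset.sum_congr rfl fun k _ => ?_
    have : (N k : ℝ) ≠ 0 := by exact_mod_cast (hN k).ne'
    unfold clusterVar
    rw [Fintype.card_fin]
    field_simp

/-! ### Feasible matrices, optimal test matrices and existence of minimizers. -/

lemma mem_spectralFeasible_iff {V : Type*} [Fintype V] {r : ℕ} {X : Matrix V (Fin r) ℝ} :
    X ∈ spectralFeasible V r ↔
      (∀ a b, ∑ i, X i a * X i b = if a = b then 1 else 0) ∧ ∀ a, ∑ i, X i a = 0 := by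
  unfold spectralFeasible
  rw [Set.mem_ofPred_eq, ← Matrix.ext_iff, funext_iff]
  simp [Matrix.mul_apply, Matrix.mulVec, dotProduct, Matrix.one_apply]

lemma sum_sq_of_feasible {V : Type*} [Fintype V] {r : ℕ} {X : Matrix V (Fin r) ℝ}
    (hX : X ∈ spectralFeasible V r) (j : Fin r) : ∑ i, X i j ^ 2 = 1 := by
  simpa [sq] using (mem_spectralFeasible_iff.1 hX).1 j j

/-- The orthogonal complement of `u` has codimension at most one, so its orthonormal basis has at
least `r` members. -/
lemma exists_orthonormal_orthogonal {ι : Type*} [Fintype ι] (u : ι → ℝ) {r : ℕ}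
    (h : r + 1 ≤ Fintype.card ι) :
    ∃ f : Fin r → ι → ℝ, (∀ a b, ∑ i, f a i * f b i = if a = b then 1 else 0) ∧
      ∀ a, ∑ i, f a i * u i = 0 := by
  let v : EuclideanSpace ℝ ι := WithLp.toLp 2 u
  let W : Submodule ℝ (EuclideanSpace ℝ ι) := (Submodule.span ℝ {v})ᗮ
  have hW : r ≤ Module.finrank ℝ W := by
    have h1 := Submodule.finrank_add_finrank_orthogonal (Submodule.span ℝ {v})
    have h2 : Module.finrank ℝ (Submodule.span ℝ {v}) ≤ 1 := by
      simpa using finrank_span_le_card (R := ℝ) ({v} : Set (EuclideanSpace ℝ ι))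
    rw [finrank_euclideanSpace] at h1
    change r ≤ Module.finrank ℝ (Submodule.span ℝ {v})ᗮ
    omega
  let b := stdOrthonormalBasis ℝ W
  refine ⟨fun a i => (b (Fin.castLE hW a) : EuclideanSpace ℝ ι) i, fun a c => ?_, fun a => ?_⟩
  · have := orthonormal_iff_ite.1 b.orthonormal (Fin.castLE hW c) (Fin.castLE hW a)
    rw [Submodule.coe_inner, PiLp.inner_apply] at this
    simpa [eq_comm] using this
  · have := (Submodule.mem_orthogonal_singleton_iff_inner_right).1 (b (Fin.castLE hW a)).2
    rw [PiLp.inner_apply] at this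
    simpa [v, mul_comm] using this

lemma spectralFeasible_nonempty {V : Type*} [Fintype V] {r : ℕ} (h : r + 1 ≤ Fintype.card V) :
    (spectralFeasible V r).Nonempty := by
  obtain ⟨f, h1, h2⟩ := exists_orthonormal_orthogonal (fun _ : V => (1 : ℝ)) h
  exact ⟨fun i a => f a i, mem_spectralFeasible_iff.2 ⟨h1, by simpa using h2⟩⟩

/-- Spreading a coordinate over cluster `k` with factor `1 / √(N k)` embeds `ℝ^K` isometrically as
the vectors constant on clusters. Orthogonality to the constants becomes orthogonality to `√(N k)`.
-/
lemma exists_feasible_clusterVar_eq_zero {K : ℕ} {N : Fin K → ℕ} (hN : ∀ k, 0 < N k) {r : ℕ}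
    (hr : r + 1 ≤ K) :
    ∃ X ∈ spectralFeasible (ClusterNode N) r, ∀ j k, clusterVar (fun u => X u j) k = 0 := by
  obtain ⟨f, h1, h2⟩ := exists_orthonormal_orthogonal (fun k => √(N k : ℝ)) (r := r)
    (by simpa using hr)
  have hs : ∀ k, √(N k : ℝ) ≠ 0 := fun k => (Real.sqrt_pos.2 (by exact_mod_cast hN k)).ne'
  have hsq : ∀ k, √(N k : ℝ) ^ 2 = N k := fun k => Real.sq_sqrt (Nat.cast_nonneg _)
  refine ⟨fun u a => f a u.1 / √(N u.1 : ℝ), mem_spectralFeasible_iff.2 ⟨fun a b => ?_,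
    fun a => ?_⟩, fun j k => ?_⟩
  · rw [← h1 a b, Fintype.sum_sigma]
    refine Finset.sum_congr rfl fun k _ => ?_
    simp only [Finset.sum_const, Finset.card_univ, Fintype.card_fin, nsmul_eq_mul]
    have := hs k
    field_simp
    rw [hsq k]
    ring
  · rw [← h2 a, Fintype.sum_sigma]
    refine Finset.sum_congr rfl fun k _ => ?_
    simp only [Finset.sum_const, Finset.card_univ, Fintype.card_fin, nsmul_eq_mul]
    have := hs k
    field_simp
    rw [hsq k, mul_comm]
  · unfold clusterVar
    simp only [Finset.sum_const, Finset.card_univ, Fintype.card_fin, nsmul_eq_mul]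
    have : (N k : ℝ) ≠ 0 := by exact_mod_cast (hN k).ne'
    field_simp
    ring

/-- Centred orthonormal columns on cluster `k₀`, extended by zero: the optimal configuration when
the coefficient of `k₀` is the smallest and is not positive. -/
lemma exists_feasible_clusterVar_eq_single {K : ℕ} {N : Fin K → ℕ} (k₀ : Fin K) {r : ℕ}
    (hr : r + 1 ≤ N k₀) :
    ∃ X ∈ spectralFeasible (ClusterNode N) r,
      ∀ j k, clusterVar (fun u => X u j) k = if k = k₀ then 1 else 0 := by
  obtain ⟨f, h1, h2⟩ := exists_orthonormal_orthogonal (fun _ : Fin (N k₀) => (1 : ℝ)) (r := r)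
    (by simpa using hr)
  let X : Matrix (ClusterNode N) (Fin r) ℝ :=
    fun u a => if h : u.1 = k₀ then f a (Fin.cast (congrArg N h) u.2) else 0
  have hX0 : ∀ i a, X ⟨k₀, i⟩ a = f a i := fun i a => by simp [X]
  have hX1 : ∀ k, k ≠ k₀ → ∀ i a, X ⟨k, i⟩ a = 0 := fun k hk i a => by simp [X, hk]
  refine ⟨X, mem_spectralFeasible_iff.2 ⟨fun a b => ?_, fun a => ?_⟩, fun j k => ?_⟩
  · rw [Fintype.sum_sigma, Finset.sum_eq_single k₀]
    · simpa [hX0] using h1 a b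
    · intro k _ hk
      simp [hX1 k hk]
    · simp
  · rw [Fintype.sum_sigma, Finset.sum_eq_single k₀]
    · simpa [hX0] using h2 a
    · intro k _ hk
      simp [hX1 k hk]
    · simp
  · unfold clusterVar
    split_ifs with hk
    · subst hk
      have h3 : ∑ i, f j i = 0 := by simpa using h2 j
      have h4 : ∑ i, f j i ^ 2 = 1 := by simpa [sq] using h1 j j
      simp [hX0, h3, h4]
    · simp [hX1 k hk]

section Objective

variable {V : Type*} [Fintype V] [DecidableEq V] {r : ℕ} (G : SimpleGraph V)

lemma partialEigSum_le {X : Matrix V (Fin r) ℝ} (hX : X ∈ spectralFeasible V r) :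
    partialEigSum r (graphLaplacian G) ≤ ∑ j, weightedForm (adjWeight G) (fun i => X i j) := by
  rw [← trace_graphLaplacian]
  refine csInf_le ⟨0, ?_⟩ ⟨X, hX, rfl⟩
  rintro _ ⟨Z, -, rfl⟩
  simp only [trace_graphLaplacian]
  exact Finset.sum_nonneg fun j _ => weightedForm_adjWeight_nonneg G _

lemma le_partialEigSum (hne : (spectralFeasible V r).Nonempty) {B : ℝ}
    (hB : ∀ X ∈ spectralFeasible V r, B ≤ ∑ j, weightedForm (adjWeight G) (fun i => X i j)) :
    B ≤ partialEigSum r (graphLaplacian G) := by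
  refine le_csInf (hne.image _) ?_
  rintro _ ⟨Z, hZ, rfl⟩
  simp only [trace_graphLaplacian]
  exact hB Z hZ

end Objective

/-- The feasible set is compact. Uniqueness of the critical value needs an actual minimizer, since
coherence and incoherence only quantify over minimizers. -/
lemma exists_isSpectralSolution {V : Type*} [Fintype V] {r : ℕ}
    (hne : (spectralFeasible V r).Nonempty) (L : Matrix V V ℝ) :
    ∃ Y : Matrix V (Fin r) ℝ, IsSpectralSolution L Y := by
  have hclosed : IsClosed (spectralFeasible V r) := by
    refine IsClosed.inter (s₁ := {X : Matrix V (Fin r) ℝ | X.transpose * X = 1})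
      (s₂ := {X : Matrix V (Fin r) ℝ | X.transpose.mulVec (fun _ => 1) = 0}) ?_ ?_
    · exact isClosed_eq (by fun_prop) continuous_const
    · exact isClosed_eq (by fun_prop) continuous_const
  have hbox : IsCompact (Set.univ.pi fun _ : V => Set.univ.pi fun _ : Fin r =>
      Set.Icc (-1 : ℝ) 1) :=
    isCompact_univ_pi fun _ => isCompact_univ_pi fun _ => isCompact_Icc
  have hsub : spectralFeasible V r ⊆ Set.univ.pi fun _ : V => Set.univ.pi fun _ : Fin r =>
      Set.Icc (-1 : ℝ) 1 := by
    intro X hX i _ j _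
    rw [Set.mem_Icc, ← abs_le, ← sq_le_one_iff_abs_le_one, ← sum_sq_of_feasible hX j]
    exact Finset.single_le_sum (f := fun i => X i j ^ 2) (fun i _ => sq_nonneg _)
      (Finset.mem_univ i)
  have hcompact : IsCompact (spectralFeasible V r) := hbox.of_isClosed_subset hclosed hsub
  have hcont : Continuous fun X : Matrix V (Fin r) ℝ => (X.transpose * L * X).trace := by
    fun_prop
  obtain ⟨Y, hY, hmin⟩ := hcompact.exists_isMinOn hne hcont.continuousOn
  exact ⟨Y, hY, fun X hX => hmin hX⟩

lemma tendsto_ciInf {ι : Type*} [Fintype ι] [Nonempty ι] {f : ℕ → ι → ℝ} {g : ι → ℝ}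
    (h : ∀ i, Tendsto (fun m => f m i) atTop (𝓝 (g i))) :
    Tendsto (fun m => ⨅ i, f m i) atTop (𝓝 (⨅ i, g i)) := by
  simp_rw [← Finset.inf'_univ_eq_ciInf]
  exact Tendsto.finset_inf'_nhds_apply _ fun i _ => h i

/-! ### Deterministic consequences of closeness to the expected form. -/

/-- The excess of the normalized expected Laplacian form over `p ‖x‖²`. -/
noncomputable def blockExcess {K : ℕ} {N : Fin K → ℕ} (pin : Fin K → ℝ) (p : ℝ)
    (x : ClusterNode N → ℝ) : ℝ :=
  ∑ k, (N k : ℝ) / (∑ l, (N l : ℝ)) * (pin k - p) * clusterVar x k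

/-- The smallest coefficient of `blockExcess`. -/
noncomputable def minExcess {K : ℕ} (N : Fin K → ℕ) (pin : Fin K → ℝ) (p : ℝ) : ℝ :=
  ⨅ k, (N k : ℝ) / (∑ l, (N l : ℝ)) * (pin k - p)

/-- The Laplacian form of `G` is within `δ n ‖x‖²` of the expected one. -/
def IsNearBlock {K : ℕ} {N : Fin K → ℕ} (G : SimpleGraph (ClusterNode N)) (pin : Fin K → ℝ)
    (p δ : ℝ) : Prop :=
  ∀ x : ClusterNode N → ℝ,
    |weightedForm (adjWeight G) x - weightedForm (blockWeight N pin p) x|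
      ≤ δ * (∑ k, (N k : ℝ)) * ∑ u, x u ^ 2

section Deterministic

variable {K : ℕ} {N : Fin K → ℕ} {pin : Fin K → ℝ} {p : ℝ} {r : ℕ}

lemma minExcess_le (N : Fin K → ℕ) (pin : Fin K → ℝ) (p : ℝ) (k : Fin K) :
    minExcess N pin p ≤ (N k : ℝ) / (∑ l, (N l : ℝ)) * (pin k - p) :=
  ciInf_le (Set.finite_range _).bddBelow k

lemma exists_minExcess_eq (hK : 0 < K) (N : Fin K → ℕ) (pin : Fin K → ℝ) (p : ℝ) :
    ∃ k, minExcess N pin p = (N k : ℝ) / (∑ l, (N l : ℝ)) * (pin k - p) := by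
  have : Nonempty (Fin K) := ⟨⟨0, hK⟩⟩
  obtain ⟨k, hk⟩ := exists_eq_ciInf_of_finite
    (f := fun k => (N k : ℝ) / (∑ l, (N l : ℝ)) * (pin k - p))
  exact ⟨k, hk.symm⟩

lemma minExcess_mul_le (x : ClusterNode N → ℝ) :
    minExcess N pin p * ∑ k, clusterVar x k ≤ blockExcess pin p x := by
  unfold blockExcess
  rw [Finset.mul_sum]
  exact Finset.sum_le_sum fun k _ =>
    mul_le_mul_of_nonneg_right (minExcess_le N pin p k) (clusterVar_nonneg x k)

lemma sum_clusterVar_le (x : ClusterNode N → ℝ) : ∑ k, clusterVar x k ≤ ∑ u, x u ^ 2 := by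
  rw [sum_clusterVar]
  have : 0 ≤ ∑ k, (∑ i, x ⟨k, i⟩) ^ 2 / (N k : ℝ) := Finset.sum_nonneg fun k _ => by positivity
  linarith

/-- The cluster variances sum to some `s` in `[0, 1]`, and `minExcess * s` is smallest at an
endpoint. -/
lemma min_minExcess_le {x : ClusterNode N → ℝ} (hx : ∑ u, x u ^ 2 = 1) :
    min 0 (minExcess N pin p) ≤ blockExcess pin p x := by
  refine le_trans ?_ (minExcess_mul_le x)
  have h1 := sum_clusterVar_le x
  have h0 : 0 ≤ ∑ k, clusterVar x k := Finset.sum_nonneg fun k _ => clusterVar_nonneg x k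
  rw [hx] at h1
  rcases le_total 0 (minExcess N pin p) with h | h
  · rw [min_eq_left h]
    positivity
  · rw [min_eq_right h]
    nlinarith

/-- All columns attain the one-column bound at once, so the minimal total excess is exactly `r`
times the one-column minimum. -/
lemma exists_feasible_blockExcess_eq (hK : r + 1 ≤ K) (hN : ∀ k, r + 1 ≤ N k) :
    ∃ X ∈ spectralFeasible (ClusterNode N) r,
      ∀ j, blockExcess pin p (fun u => X u j) = min 0 (minExcess N pin p) := by
  rcases le_total 0 (minExcess N pin p) with h | h
  · rw [min_eq_left h]
    obtain ⟨X, hX, h0⟩ := exists_feasible_clusterVar_eq_zero (N := N)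
      (fun k => (Nat.succ_pos r).trans_le (hN k)) hK
    exact ⟨X, hX, fun j => by simp [blockExcess, h0]⟩
  · rw [min_eq_right h]
    obtain ⟨k, hk⟩ := exists_minExcess_eq (by omega) N pin p
    obtain ⟨X, hX, h0⟩ := exists_feasible_clusterVar_eq_single k (hN k)
    exact ⟨X, hX, fun j => by simp [blockExcess, h0, hk]⟩

variable {G : SimpleGraph (ClusterNode N)} {δ : ℝ}

lemma abs_objective_div_sub_le (hK : 0 < K) (hN : ∀ k, 0 < N k) (hG : IsNearBlock G pin p δ)
    {X : Matrix (ClusterNode N) (Fin r) ℝ} (hX : X ∈ spectralFeasible (ClusterNode N) r) :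
    |(∑ j, weightedForm (adjWeight G) (fun u => X u j)) / ∑ k, (N k : ℝ)
      - (r * p + ∑ j, blockExcess pin p (fun u => X u j))| ≤ r * δ := by
  have hpos : 0 < ∑ k, (N k : ℝ) :=
    Finset.sum_pos (fun k _ => by exact_mod_cast hN k) ⟨⟨0, hK⟩, Finset.mem_univ _⟩
  have hcol : ∀ j, |weightedForm (adjWeight G) (fun u => X u j) / ∑ k, (N k : ℝ)
      - (p + blockExcess pin p (fun u => X u j))| ≤ δ := by
    intro j
    have h1 := hG (fun u => X u j)
    rw [weightedForm_blockWeight hN pin p _ ((mem_spectralFeasible_iff.1 hX).2 j),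
      sum_sq_of_feasible hX j, mul_one, mul_one] at h1
    have h2 : ∑ k, N k * (pin k - p) * clusterVar (fun u => X u j) k
        = (∑ k, (N k : ℝ)) * blockExcess pin p (fun u => X u j) := by
      unfold blockExcess
      rw [Finset.mul_sum]
      refine Finset.sum_congr rfl fun k _ => ?_
      field_simp
    rw [h2] at h1
    have h3 : weightedForm (adjWeight G) (fun u => X u j) / ∑ k, (N k : ℝ)
        - (p + blockExcess pin p (fun u => X u j))
        = (weightedForm (adjWeight G) (fun u => X u j) - (p * ∑ k, (N k : ℝ)
          + (∑ k, (N k : ℝ)) * blockExcess pin p (fun u => X u j))) / ∑ k, (N k : ℝ) := by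
      field_simp
    rw [h3, abs_div, abs_of_pos hpos, div_le_iff₀ hpos]
    exact h1
  have hsum : (∑ j, weightedForm (adjWeight G) (fun u => X u j)) / ∑ k, (N k : ℝ)
      - (r * p + ∑ j, blockExcess pin p (fun u => X u j))
      = ∑ j, (weightedForm (adjWeight G) (fun u => X u j) / ∑ k, (N k : ℝ)
        - (p + blockExcess pin p (fun u => X u j))) := by
    rw [Finset.sum_sub_distrib, Finset.sum_add_distrib, Finset.sum_div]
    simp
  rw [hsum]
  refine (Finset.abs_sum_le_sum_abs _ _).trans ((Finset.sum_le_sum fun j _ => hcol j).trans ?_)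
  simp

lemma abs_partialEigSum_div_sub_le (hK : r + 1 ≤ K) (hN : ∀ k, r + 1 ≤ N k)
    (hG : IsNearBlock G pin p δ) :
    |partialEigSum r (graphLaplacian G) / ∑ k, (N k : ℝ)
      - r * (p + min 0 (minExcess N pin p))| ≤ r * δ := by
  have hN0 : ∀ k, 0 < N k := fun k => (Nat.succ_pos r).trans_le (hN k)
  have hK0 : 0 < K := (Nat.succ_pos r).trans_le hK
  have hpos : 0 < ∑ k, (N k : ℝ) :=
    Finset.sum_pos (fun k _ => by exact_mod_cast hN0 k) ⟨⟨0, hK0⟩, Finset.mem_univ _⟩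
  obtain ⟨X, hX, hXe⟩ := exists_feasible_blockExcess_eq (pin := pin) (p := p) hK hN
  rw [abs_le]
  constructor
  · have : (r * (p + min 0 (minExcess N pin p)) - r * δ) * (∑ k, (N k : ℝ))
        ≤ partialEigSum r (graphLaplacian G) := by
      refine le_partialEigSum G ⟨X, hX⟩ fun Z hZ => ?_
      have h1 := (abs_le.1 (abs_objective_div_sub_le hK0 hN0 hG hZ)).1
      have h2 : ∑ _j : Fin r, min 0 (minExcess N pin p)
          ≤ ∑ j, blockExcess pin p (fun u => Z u j) :=
        Finset.sum_le_sum fun j _ => min_minExcess_le (sum_sq_of_feasible hZ j)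
      rw [Finset.sum_const, Finset.card_univ, Fintype.card_fin, nsmul_eq_mul] at h2
      rw [← le_div_iff₀ hpos]
      linarith
    rw [← le_div_iff₀ hpos] at this
    linarith
  · have h1 := (abs_le.1 (abs_objective_div_sub_le hK0 hN0 hG hX)).2
    simp_rw [hXe] at h1
    rw [Finset.sum_const, Finset.card_univ, Fintype.card_fin, nsmul_eq_mul] at h1
    have h2 := div_le_div_of_nonneg_right (partialEigSum_le G hX) hpos.le
    linarith

/-- Compare `Y` with the optimal test matrix: replacing the random objective by the expected one
costs `r * δ` for each of the two. -/
lemma sum_blockExcess_solution_le (hK : r + 1 ≤ K) (hN : ∀ k, r + 1 ≤ N k)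
    (hG : IsNearBlock G pin p δ) {Y : Matrix (ClusterNode N) (Fin r) ℝ}
    (hY : IsSpectralSolution (graphLaplacian G) Y) :
    ∑ j, blockExcess pin p (fun u => Y u j) ≤ r * min 0 (minExcess N pin p) + 2 * r * δ := by
  have hN0 : ∀ k, 0 < N k := fun k => (Nat.succ_pos r).trans_le (hN k)
  have hK0 : 0 < K := (Nat.succ_pos r).trans_le hK
  have hpos : 0 < ∑ k, (N k : ℝ) :=
    Finset.sum_pos (fun k _ => by exact_mod_cast hN0 k) ⟨⟨0, hK0⟩, Finset.mem_univ _⟩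
  obtain ⟨X, hX, hXe⟩ := exists_feasible_blockExcess_eq (pin := pin) (p := p) hK hN
  have h1 := (abs_le.1 (abs_objective_div_sub_le hK0 hN0 hG hX)).2
  have h2 := (abs_le.1 (abs_objective_div_sub_le hK0 hN0 hG hY.1)).1
  have h3 := hY.2 X hX
  rw [trace_graphLaplacian, trace_graphLaplacian] at h3
  have h4 := div_le_div_of_nonneg_right h3 hpos.le
  simp_rw [hXe] at h1
  rw [Finset.sum_const, Finset.card_univ, Fintype.card_fin, nsmul_eq_mul] at h1
  linarith

/-- All terms of the excess are nonnegative here, so each is at most the total, which is at most `2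
* r * δ`. -/
lemma clusterVar_solution_le (hK : r + 1 ≤ K) (hN : ∀ k, r + 1 ≤ N k)
    (hG : IsNearBlock G pin p δ) (hp : ∀ k, p ≤ pin k) {Y : Matrix (ClusterNode N) (Fin r) ℝ}
    (hY : IsSpectralSolution (graphLaplacian G) Y) (k : Fin K) (j : Fin r) :
    (N k : ℝ) / (∑ l, (N l : ℝ)) * (pin k - p) * clusterVar (fun u => Y u j) k ≤ 2 * r * δ := by
  have hnn : ∀ j k, 0 ≤ (N k : ℝ) / (∑ l, (N l : ℝ)) * (pin k - p) *
      clusterVar (fun u => Y u j) k := fun j k =>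
    mul_nonneg (mul_nonneg (by positivity) (sub_nonneg.2 (hp k))) (clusterVar_nonneg _ k)
  have h1 := sum_blockExcess_solution_le hK hN hG hY
  have h2 : blockExcess pin p (fun u => Y u j) ≤ ∑ j, blockExcess pin p (fun u => Y u j) :=
    Finset.single_le_sum (f := fun j => blockExcess pin p (fun u => Y u j))
      (fun j _ => Finset.sum_nonneg fun k _ => hnn j k) (Finset.mem_univ j)
  have h3 : _ ≤ blockExcess pin p (fun u => Y u j) :=
    Finset.single_le_sum (fun k _ => hnn j k) (Finset.mem_univ k)
  have h4 : (r : ℝ) * min 0 (minExcess N pin p) ≤ 0 :=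
    mul_nonpos_of_nonneg_of_nonpos (Nat.cast_nonneg _) (min_le_left _ _)
  linarith

/-- Mass in the cluster means is mass missing from the cluster variances, and each unit of it raises
the excess by at least `τ` above the minimum. Near-optimality therefore bounds this mass, summed
over columns and clusters. -/
lemma sq_clusterSum_solution_le (hK : r + 1 ≤ K) (hN : ∀ k, r + 1 ≤ N k)
    (hG : IsNearBlock G pin p δ) {τ : ℝ} (hτ : 0 ≤ τ) (hp : minExcess N pin p ≤ -τ)
    {Y : Matrix (ClusterNode N) (Fin r) ℝ}
    (hY : IsSpectralSolution (graphLaplacian G) Y) (k : Fin K) (j : Fin r) :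
    τ * ((∑ i, Y ⟨k, i⟩ j) ^ 2 / N k) ≤ 2 * r * δ := by
  have h1 := sum_blockExcess_solution_le hK hN hG hY
  have hθ : minExcess N pin p ≤ 0 := hp.trans (neg_nonpos.2 hτ)
  rw [min_eq_right hθ] at h1
  have h2 : ∀ j, minExcess N pin p + τ * ∑ k, (∑ i, Y ⟨k, i⟩ j) ^ 2 / (N k : ℝ)
      ≤ blockExcess pin p (fun u => Y u j) := by
    intro j
    refine le_trans ?_ (minExcess_mul_le _)
    rw [sum_clusterVar, sum_sq_of_feasible hY.1 j]
    have : 0 ≤ ∑ k, (∑ i, Y ⟨k, i⟩ j) ^ 2 / (N k : ℝ) :=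
      Finset.sum_nonneg fun k _ => by positivity
    nlinarith
  have h3 := Finset.sum_le_sum fun j (_ : j ∈ Finset.univ) => h2 j
  rw [Finset.sum_add_distrib, Finset.sum_const, Finset.card_univ, Fintype.card_fin,
    nsmul_eq_mul, ← Finset.mul_sum] at h3
  have h4 : ∑ k, (∑ i, Y ⟨k, i⟩ j) ^ 2 / (N k : ℝ)
      ≤ ∑ j, ∑ k, (∑ i, Y ⟨k, i⟩ j) ^ 2 / (N k : ℝ) :=
    Finset.single_le_sum (f := fun j => ∑ k, (∑ i, Y ⟨k, i⟩ j) ^ 2 / (N k : ℝ))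
      (fun j _ => Finset.sum_nonneg fun k _ => by positivity) (Finset.mem_univ j)
  have h5 : (∑ i, Y ⟨k, i⟩ j) ^ 2 / (N k : ℝ) ≤ ∑ k, (∑ i, Y ⟨k, i⟩ j) ^ 2 / (N k : ℝ) :=
    Finset.single_le_sum (f := fun k => (∑ i, Y ⟨k, i⟩ j) ^ 2 / (N k : ℝ))
      (fun k _ => by positivity) (Finset.mem_univ k)
  have h6 := mul_le_mul_of_nonneg_left (h5.trans h4) hτ
  linarith

end Deterministic

lemma abs_partialEigSum_sub_le_of_near_complete {n r : ℕ} (hn : r + 1 ≤ n)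
    {H : SimpleGraph (Fin n)} {a b : ℝ}
    (hH : ∀ x : Fin n → ℝ, |weightedForm (adjWeight H) x - weightedForm (fun _ _ => a) x|
      ≤ b * ∑ i, x i ^ 2) :
    |partialEigSum r (graphLaplacian H) - r * (a * n)| ≤ r * b := by
  have key : ∀ X ∈ spectralFeasible (Fin n) r,
      |∑ j, weightedForm (adjWeight H) (fun i => X i j) - r * (a * n)| ≤ r * b := by
    intro X hX
    have : ∑ j, weightedForm (adjWeight H) (fun i => X i j) - r * (a * n)
        = ∑ j, (weightedForm (adjWeight H) (fun i => X i j) - a * n) := by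
      simp [Finset.sum_sub_distrib]
    rw [this]
    refine (Finset.abs_sum_le_sum_abs _ _).trans
      ((Finset.sum_le_sum (g := fun _ => b) fun j _ => ?_).trans (by simp))
    have h := hH (fun i => X i j)
    rw [weightedForm_const, (mem_spectralFeasible_iff.1 hX).2 j, sum_sq_of_feasible hX j] at h
    simpa using h
  have hne : (spectralFeasible (Fin n) r).Nonempty := spectralFeasible_nonempty (by simpa using hn)
  rw [abs_le]
  constructor
  · have : r * (a * n) - r * b ≤ partialEigSum r (graphLaplacian H) :=
      le_partialEigSum H hne fun X hX => by linarith [(abs_le.1 (key X hX)).1]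
    linarith
  · obtain ⟨X, hX⟩ := hne
    linarith [(abs_le.1 (key X hX)).2, partialEigSum_le H hX]

/-! ### Almost sure closeness along the sequence of sizes. -/

section Sequence

variable {Ω : Type*} [MeasurableSpace Ω] {μ : Measure Ω} [IsProbabilityMeasure μ] {K : ℕ}

/-- Random graphs with independent edges have almost surely a Laplacian form close to its
expectation, along any sequence of size vectors. -/
lemma ae_weightedForm_adjDev_le (hK : 0 < K) {n : ℕ → Fin K → ℕ}
    (hn : ∀ k, Tendsto (fun m => n m k) atTop atTop)
    {V : (Fin K → ℕ) → Type*} [∀ N, Fintype (V N)] [∀ N, DecidableEq (V N)]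
    (hV : ∀ N, Fintype.card (V N) ≤ ∑ k, N k)
    {H : ∀ N, Ω → SimpleGraph (V N)} (hm : ∀ N u v, MeasurableSet {ω | (H N ω).Adj u v})
    (hi : ∀ N, iIndepSet
      (fun e : {e : Sym2 (V N) // ¬ e.IsDiag} => {ω | e.1 ∈ (H N ω).edgeSet}) μ) :
    ∀ᵐ ω ∂μ, ∀ ε : ℝ, 0 < ε → ∀ᶠ m in atTop, ∀ x : V (n m) → ℝ,
      |weightedForm (adjDev μ (H (n m)) ω) x| ≤ ε * (∑ k, (n m k : ℝ)) * ∑ i, x i ^ 2 := by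
  -- Countably many tolerances `2 / (j + 1)` suffice, so that one null set serves every `ε`.
  have key : ∀ j : ℕ, ∀ᵐ ω ∂μ, ∀ᶠ m in atTop, ∀ x : V (n m) → ℝ,
      |weightedForm (adjDev μ (H (n m)) ω) x|
        ≤ 2 * (1 / ((j : ℝ) + 1)) * (∑ k, n m k : ℕ) * ∑ i, x i ^ 2 := by
    intro j
    set η : ℝ := 1 / ((j : ℝ) + 1)
    have hη : 0 < η := Nat.one_div_pos_of_nat
    have hη1 : η ≤ 1 := by
      rw [div_le_one (by positivity)]
      linarith [(Nat.cast_nonneg j : (0 : ℝ) ≤ j)]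
    obtain ⟨C, a, hC, ha, hCa⟩ := exists_exp_bound (pow_pos hη 8)
    have hb : ∀ N, μ {ω | ¬ ∀ x : V N → ℝ, |weightedForm (adjDev μ (H N) ω) x|
        ≤ 2 * η * (∑ k, N k : ℕ) * ∑ i, x i ^ 2}
        ≤ ENNReal.ofReal (C * Real.exp (-a * (∑ k, N k : ℕ))) := by
      intro N
      rcases Nat.eq_zero_or_pos (∑ k, N k) with h0 | h0
      · rw [h0]
        refine prob_le_one.trans ?_
        rw [← ENNReal.ofReal_one]
        exact ENNReal.ofReal_le_ofReal (by simpa using hC)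
      · exact (measure_abs_weightedForm_gt_le (hm N) (hi N) (hV N) h0 hη.le hη1).trans
          (ENNReal.ofReal_le_ofReal (hCa _))
    filter_upwards [ae_eventually_notMem_of_sizes hK hn ha hb] with ω hω
    filter_upwards [hω] with m hm'
    exact not_not.1 hm'
  filter_upwards [ae_all_iff.2 key] with ω hω ε hε
  obtain ⟨j, hj⟩ := exists_nat_one_div_lt (half_pos hε)
  filter_upwards [hω j] with m hm' x
  refine (hm' x).trans ?_
  push_cast
  have : 2 * (1 / ((j : ℝ) + 1)) ≤ ε := by linarith
  have hq : 0 ≤ ∑ i, x i ^ 2 := Finset.sum_nonneg fun i _ => sq_nonneg _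
  gcongr

variable {pin : Fin K → ℝ} {p : ℝ} {G : ∀ N : Fin K → ℕ, Ω → SimpleGraph (ClusterNode N)}

lemma IsSBM.ae_eventually_isNearBlock (hK : 0 < K) {n : ℕ → Fin K → ℕ}
    (hn : ∀ k, Tendsto (fun m => n m k) atTop atTop) (hpin : ∀ k, 0 ≤ pin k) (hp : 0 ≤ p)
    (hG : ∀ N, IsSBM μ N pin p (G N)) :
    ∀ᵐ ω ∂μ, ∀ δ : ℝ, 0 < δ → ∀ᶠ m in atTop, IsNearBlock (G (n m) ω) pin p δ := by
  have h := ae_weightedForm_adjDev_le (V := fun N : Fin K → ℕ => ClusterNode N) (H := G) hK hn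
    (fun N => by simp [Fintype.card_sigma]) (fun N => (hG N).measurable_adj)
    (fun N => (hG N).indep_edges)
  filter_upwards [h] with ω hω δ hδ
  filter_upwards [hω δ hδ] with m hm x
  have h1 := hm x
  unfold adjDev at h1
  rw [weightedForm_sub] at h1
  -- The edge probabilities and `blockWeight` may differ on the diagonal, which the form does not
  -- see.
  rwa [weightedForm_congr (P := fun i j => μ.real _) (Q := blockWeight (n m) pin p)] at h1
  intro u v huv
  rw [measureReal_def, (hG (n m)).prob_adj u v huv, ENNReal.toReal_ofReal, blockWeight]
  split_ifs
  exacts [hpin _, hp]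

lemma IsSBM.ae_eventually_cluster (hK : 0 < K) {n : ℕ → Fin K → ℕ}
    (hn : ∀ k, Tendsto (fun m => n m k) atTop atTop) (hpin : ∀ k, 0 ≤ pin k)
    (hG : ∀ N, IsSBM μ N pin p (G N)) (k : Fin K) :
    ∀ᵐ ω ∂μ, ∀ δ : ℝ, 0 < δ → ∀ᶠ m in atTop, ∀ x : Fin (n m k) → ℝ,
      |weightedForm (adjWeight (clusterGraph (G (n m) ω) k)) x - weightedForm (fun _ _ => pin k) x|
        ≤ δ * (∑ k, (n m k : ℝ)) * ∑ i, x i ^ 2 := by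
  have h := ae_weightedForm_adjDev_le (μ := μ) (V := fun N : Fin K → ℕ => Fin (N k))
    (H := fun N ω => clusterGraph (G N ω) k) hK hn
    (fun N => by
      rw [Fintype.card_fin]
      exact Finset.single_le_sum (f := N) (fun _ _ => Nat.zero_le _) (Finset.mem_univ k))
    (fun N u v => (hG N).measurable_adj ⟨k, u⟩ ⟨k, v⟩)
    (fun N => by
      have hinj : Function.Injective (fun i : Fin (N k) => (⟨k, i⟩ : ClusterNode N)) :=
        fun i j h => by simpa using h
      -- The edges of the cluster inject into those of the whole graph, so independence is inherited
      -- by restriction of the index family.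
      let g : {e : Sym2 (Fin (N k)) // ¬ e.IsDiag} → {e : Sym2 (ClusterNode N) // ¬ e.IsDiag} :=
        fun e => ⟨e.1.map (fun i => ⟨k, i⟩), by
          rw [Sym2.isDiag_map hinj]
          exact e.2⟩
      have hg : Function.Injective g := fun e f hef =>
        Subtype.ext (Sym2.map.injective hinj (congrArg Subtype.val hef))
      have h := (hG N).indep_edges.precomp hg
      convert h using 2 with e
      obtain ⟨e, he⟩ := e
      induction e with
      | _ u v => rfl)
  filter_upwards [h] with ω hω δ hδ
  filter_upwards [hω δ hδ] with m hm x
  have h1 := hm x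
  unfold adjDev at h1
  rw [weightedForm_sub] at h1
  rwa [weightedForm_congr (P := fun i j => μ.real _) (Q := fun _ _ => pin k)] at h1
  intro u v huv
  have h2 := (hG (n m)).prob_adj ⟨k, u⟩ ⟨k, v⟩ (fun h => huv (by simpa using h))
  rw [if_pos rfl] at h2
  change (μ {ω | (G (n m) ω).Adj ⟨k, u⟩ ⟨k, v⟩}).toReal = pin k
  rw [h2, ENNReal.toReal_ofReal (hpin k)]

end Sequence

/-! ### Passage to the limit in the sizes. -/

/-- Bias–variance decomposition: the best constant is the mean of the rescaled entries, and the
remaining error is the cluster variance. -/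
lemma mean_sq_sub_eq {n : ℕ} (hn : 0 < n) (y : Fin n → ℝ) (v : ℝ) :
    (1 / (n : ℝ)) * ∑ i, (√(n : ℝ) * y i - v) ^ 2
      = (∑ i, y i ^ 2 - (∑ i, y i) ^ 2 / n) + (v - (∑ i, y i) / √(n : ℝ)) ^ 2 := by
  have hs : √(n : ℝ) ≠ 0 := (Real.sqrt_pos.2 (by exact_mod_cast hn)).ne'
  have hsq : √(n : ℝ) ^ 2 = n := Real.sq_sqrt (Nat.cast_nonneg _)
  have h : ∑ i, (√(n : ℝ) * y i - v) ^ 2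
      = √(n : ℝ) ^ 2 * ∑ i, y i ^ 2 - 2 * √(n : ℝ) * v * ∑ i, y i + n * v ^ 2 := by
    have h1 : ∀ i, (√(n : ℝ) * y i - v) ^ 2
        = √(n : ℝ) ^ 2 * y i ^ 2 - 2 * √(n : ℝ) * v * y i + v ^ 2 := fun i => by ring
    simp_rw [h1, Finset.sum_add_distrib, Finset.sum_sub_distrib, ← Finset.mul_sum]
    simp
  rw [h]
  generalize √(n : ℝ) = s at hs hsq
  rw [← hsq]
  field_simp
  ring

lemma mean_eq {n : ℕ} (y : Fin n → ℝ) :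
    (1 / (n : ℝ)) * ∑ i, √(n : ℝ) * y i = (∑ i, y i) / √(n : ℝ) := by
  rw [← Finset.mul_sum]
  rcases Nat.eq_zero_or_pos n with rfl | hn
  · simp
  have hs : √(n : ℝ) ≠ 0 := (Real.sqrt_pos.2 (by exact_mod_cast hn)).ne'
  have hsq : √(n : ℝ) ^ 2 = n := Real.sq_sqrt (Nat.cast_nonneg _)
  nth_rewrite 1 [← hsq]
  field_simp

section Limits

variable {K : ℕ} {n : ℕ → Fin K → ℕ} {ρ : Fin K → ℝ} {c : ℝ}

lemma limit_ratio_le_one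
    (hnc : Tendsto (fun m => (⨅ k, (n m k : ℝ)) / ⨆ k, (n m k : ℝ)) atTop (𝓝 c)) (hK : 0 < K) :
    c ≤ 1 := by
  refine le_of_tendsto' hnc fun m => ?_
  have hb : ∀ k, (⨅ k, (n m k : ℝ)) ≤ n m k := fun k => ciInf_le (Set.finite_range _).bddBelow k
  have ht : ∀ k, (n m k : ℝ) ≤ ⨆ k, (n m k : ℝ) := fun k =>
    le_ciSup (f := fun k => (n m k : ℝ)) (Set.finite_range _).bddAbove k
  exact div_le_one_of_le₀ ((hb ⟨0, hK⟩).trans (ht ⟨0, hK⟩))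
    ((Nat.cast_nonneg _).trans (ht ⟨0, hK⟩))

/-- The total size is at most `K` times the largest cluster, so the limiting fraction is at least `c
/ K`. -/
lemma limit_fraction_pos
    (hρ : ∀ k, Tendsto (fun m => (n m k : ℝ) / ∑ l, (n m l : ℝ)) atTop (𝓝 (ρ k))) (hc : 0 < c)
    (hnc : Tendsto (fun m => (⨅ k, (n m k : ℝ)) / ⨆ k, (n m k : ℝ)) atTop (𝓝 c)) (hK : 0 < K)
    (hn : ∀ k, Tendsto (fun m => n m k) atTop atTop) (k : Fin K) : 0 < ρ k := by
  have hKR : (0 : ℝ) < K := by exact_mod_cast hK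
  refine (div_pos hc hKR).trans_le (le_of_tendsto_of_tendsto (hnc.div_const _) (hρ k) ?_)
  filter_upwards [(hn k).eventually_gt_atTop 0] with m hm
  have hb : (⨅ k, (n m k : ℝ)) ≤ n m k := ciInf_le (Set.finite_range _).bddBelow k
  have ht : ∀ k, (n m k : ℝ) ≤ ⨆ k, (n m k : ℝ) := fun k =>
    le_ciSup (f := fun k => (n m k : ℝ)) (Set.finite_range _).bddAbove k
  have hpos : (0 : ℝ) < n m k := by exact_mod_cast hm
  have hsum : ∑ l, (n m l : ℝ) ≤ (⨆ k, (n m k : ℝ)) * K :=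
    (Finset.sum_le_sum fun l _ => ht l).trans (by simp [mul_comm])
  have hsum0 : 0 < ∑ l, (n m l : ℝ) :=
    hpos.trans_le (Finset.single_le_sum (f := fun l => (n m l : ℝ))
      (fun l _ => Nat.cast_nonneg _) (Finset.mem_univ k))
  rw [div_div]
  gcongr

lemma tendsto_minExcess (hK : 0 < K)
    (hρ : ∀ k, Tendsto (fun m => (n m k : ℝ) / ∑ l, (n m l : ℝ)) atTop (𝓝 (ρ k)))
    (pin : Fin K → ℝ) (p : ℝ) :
    Tendsto (fun m => minExcess (n m) pin p) atTop (𝓝 (⨅ k, ρ k * (pin k - p))) := by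
  have : Nonempty (Fin K) := ⟨⟨0, hK⟩⟩
  exact tendsto_ciInf fun k => (hρ k).mul_const _

lemma eventually_sizes_ge (hn : ∀ k, Tendsto (fun m => n m k) atTop atTop) (s : ℕ) :
    ∀ᶠ m in atTop, ∀ k, s ≤ n m k :=
  eventually_all.2 fun k => (hn k).eventually_ge_atTop s

variable {r : ℕ} {pin : Fin K → ℝ} {p : ℝ} {H : ∀ m, SimpleGraph (ClusterNode (n m))}

lemma tendsto_partialEigSum_div (hK : r + 1 ≤ K)
    (hn : ∀ k, Tendsto (fun m => n m k) atTop atTop)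
    (hρ : ∀ k, Tendsto (fun m => (n m k : ℝ) / ∑ l, (n m l : ℝ)) atTop (𝓝 (ρ k)))
    (hH : ∀ δ : ℝ, 0 < δ → ∀ᶠ m in atTop, IsNearBlock (H m) pin p δ) :
    Tendsto (fun m => partialEigSum r (graphLaplacian (H m)) / ∑ k, (n m k : ℝ)) atTop
      (𝓝 (r * (p + min 0 (⨅ k, ρ k * (pin k - p))))) := by
  have h1 : Tendsto (fun m => (r : ℝ) * (p + min 0 (minExcess (n m) pin p))) atTop
      (𝓝 (r * (p + min 0 (⨅ k, ρ k * (pin k - p))))) :=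
    ((tendsto_const_nhds.min (tendsto_minExcess ((Nat.succ_pos r).trans_le hK) hρ pin p)).const_add
      p).const_mul _
  refine h1.congr_dist ?_
  rw [Metric.tendsto_atTop']
  intro ε hε
  obtain ⟨M, hM⟩ := eventually_atTop.1
    ((hH (ε / (r + 1)) (by positivity)).and (eventually_sizes_ge hn (r + 1)))
  refine ⟨M, fun m hm => ?_⟩
  obtain ⟨h2, h3⟩ := hM m hm.le
  have h4 := abs_partialEigSum_div_sub_le hK h3 h2
  rw [Real.dist_eq, sub_zero, abs_of_nonneg dist_nonneg, dist_comm, Real.dist_eq]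
  refine h4.trans_lt ?_
  rw [mul_div_assoc', div_lt_iff₀ (by positivity)]
  nlinarith

lemma tendsto_iInf_partialEigSum_div (hK : 0 < K)
    (hn : ∀ k, Tendsto (fun m => n m k) atTop atTop)
    (hρ : ∀ k, Tendsto (fun m => (n m k : ℝ) / ∑ l, (n m l : ℝ)) atTop (𝓝 (ρ k)))
    (hH : ∀ k, ∀ δ : ℝ, 0 < δ → ∀ᶠ m in atTop, ∀ x : Fin (n m k) → ℝ,
      |weightedForm (adjWeight (clusterGraph (H m) k)) x - weightedForm (fun _ _ => pin k) x|
        ≤ δ * (∑ k, (n m k : ℝ)) * ∑ i, x i ^ 2) :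
    Tendsto (fun m => (⨅ k, partialEigSum r (graphLaplacian (clusterGraph (H m) k)))
      / ∑ k, (n m k : ℝ)) atTop (𝓝 (r * ⨅ k, ρ k * pin k)) := by
  have : Nonempty (Fin K) := ⟨⟨0, hK⟩⟩
  have hr : (0 : ℝ) ≤ r := Nat.cast_nonneg r
  have h0 : ∀ m, 0 ≤ (∑ k, (n m k : ℝ))⁻¹ := fun m => by positivity
  simp_rw [div_eq_mul_inv, Real.iInf_mul_of_nonneg (h0 _)]
  rw [Real.mul_iInf_of_nonneg hr]
  refine tendsto_ciInf fun k => ?_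
  have h1 : Tendsto (fun m => (r : ℝ) * ((n m k : ℝ) / (∑ k, (n m k : ℝ)) * pin k)) atTop
      (𝓝 (r * (ρ k * pin k))) := ((hρ k).mul_const _).const_mul _
  refine h1.congr_dist ?_
  rw [Metric.tendsto_atTop']
  intro ε hε
  obtain ⟨M, hM⟩ := eventually_atTop.1
    ((hH k (ε / (r + 1)) (by positivity)).and (eventually_sizes_ge hn (r + 1)))
  refine ⟨M, fun m hm => ?_⟩
  obtain ⟨h2, h3⟩ := hM m hm.le
  have hpos : 0 < ∑ k, (n m k : ℝ) :=
    Finset.sum_pos (fun k _ => by exact_mod_cast (Nat.succ_pos r).trans_le (h3 k))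
      Finset.univ_nonempty
  have h4 := abs_partialEigSum_sub_le_of_near_complete (h3 k) h2
  rw [Real.dist_eq, sub_zero, abs_of_nonneg dist_nonneg, dist_comm, Real.dist_eq]
  have h5 : partialEigSum r (graphLaplacian (clusterGraph (H m) k)) * (∑ k, (n m k : ℝ))⁻¹
      - r * ((n m k : ℝ) / (∑ k, (n m k : ℝ)) * pin k)
      = (partialEigSum r (graphLaplacian (clusterGraph (H m) k)) - r * (pin k * n m k))
        / ∑ k, (n m k : ℝ) := by
    field_simp
  rw [h5, abs_div, abs_of_pos hpos, div_lt_iff₀ hpos]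
  refine h4.trans_lt ?_
  have h6 : (r : ℝ) * (ε / (r + 1)) < ε := by
    rw [mul_div_assoc', div_lt_iff₀ (by positivity)]
    nlinarith
  rw [← mul_assoc]
  exact mul_lt_mul_of_pos_right h6 hpos

lemma eventually_fraction_gt_half (hρ0 : ∀ k, 0 < ρ k)
    (hρ : ∀ k, Tendsto (fun m => (n m k : ℝ) / ∑ l, (n m l : ℝ)) atTop (𝓝 (ρ k))) (k : Fin K) :
    ∀ᶠ m in atTop, ρ k / 2 < (n m k : ℝ) / ∑ l, (n m l : ℝ) :=
  (hρ k).eventually_const_lt (half_lt_self (hρ0 k))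

lemma eventually_coherent (hK : r + 1 ≤ K) (hn : ∀ k, Tendsto (fun m => n m k) atTop atTop)
    (hρ0 : ∀ k, 0 < ρ k)
    (hρ : ∀ k, Tendsto (fun m => (n m k : ℝ) / ∑ l, (n m l : ℝ)) atTop (𝓝 (ρ k)))
    (hp : ∀ k, p < pin k)
    (hH : ∀ δ : ℝ, 0 < δ → ∀ᶠ m in atTop, IsNearBlock (H m) pin p δ) {ε : ℝ} (hε : 0 < ε) :
    ∀ᶠ m in atTop, ∀ Y : Matrix (ClusterNode (n m)) (Fin r) ℝ,
      IsSpectralSolution (graphLaplacian (H m)) Y → ∀ k, ∃ v : Fin r → ℝ, ∀ j,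
        (1 / (n m k : ℝ)) * ∑ i, (√(n m k : ℝ) * Y ⟨k, i⟩ j - v j) ^ 2 ≤ ε := by
  have key : ∀ k, ∀ᶠ m in atTop, ∀ Y : Matrix (ClusterNode (n m)) (Fin r) ℝ,
      IsSpectralSolution (graphLaplacian (H m)) Y → ∃ v : Fin r → ℝ, ∀ j,
        (1 / (n m k : ℝ)) * ∑ i, (√(n m k : ℝ) * Y ⟨k, i⟩ j - v j) ^ 2 ≤ ε := by
    intro k
    have hg : 0 < ρ k / 2 * (pin k - p) := mul_pos (half_pos (hρ0 k)) (sub_pos.2 (hp k))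
    set g := ρ k / 2 * (pin k - p) with hgdef
    -- Eventually `g` is a lower bound for the coefficient of the variance on cluster `k`, and this
    -- tolerance makes `2 * r * δ ≤ g * ε`. The `+ 1` covers `r = 0`.
    filter_upwards [hH (g * ε / (2 * r + 1)) (by positivity), eventually_sizes_ge hn (r + 1),
      eventually_fraction_gt_half hρ0 hρ k] with m h1 h2 h3 Y hY
    refine ⟨fun j => (∑ i, Y ⟨k, i⟩ j) / √(n m k : ℝ), fun j => ?_⟩
    rw [mean_sq_sub_eq ((Nat.succ_pos r).trans_le (h2 k)) (fun i => Y ⟨k, i⟩ j), sub_self]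
    have h4 := clusterVar_solution_le hK h2 h1 (fun k => (hp k).le) hY k j
    have h5 : g * clusterVar (fun u => Y u j) k ≤ g * ε := by
      calc g * clusterVar (fun u => Y u j) k
          ≤ (n m k : ℝ) / (∑ l, (n m l : ℝ)) * (pin k - p) * clusterVar (fun u => Y u j) k :=
            mul_le_mul_of_nonneg_right
              (mul_le_mul_of_nonneg_right h3.le (sub_pos.2 (hp k)).le) (clusterVar_nonneg _ k)
        _ ≤ _ := h4
        _ ≤ g * ε := by
            rw [mul_div_assoc', div_le_iff₀ (by positivity)]
            nlinarith [mul_pos hg hε]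
    have h6 := le_of_mul_le_mul_left h5 hg
    unfold clusterVar at h6
    simpa using h6
  filter_upwards [eventually_all.2 key] with m hm Y hY k
  exact hm k Y hY

lemma eventually_incoherent (hK : r + 1 ≤ K) (hn : ∀ k, Tendsto (fun m => n m k) atTop atTop)
    (hρ0 : ∀ k, 0 < ρ k)
    (hρ : ∀ k, Tendsto (fun m => (n m k : ℝ) / ∑ l, (n m l : ℝ)) atTop (𝓝 (ρ k)))
    {k₀ : Fin K} (hp : pin k₀ < p)
    (hH : ∀ δ : ℝ, 0 < δ → ∀ᶠ m in atTop, IsNearBlock (H m) pin p δ) {ε : ℝ} (hε : 0 < ε) :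
    ∀ᶠ m in atTop, ∀ Y : Matrix (ClusterNode (n m)) (Fin r) ℝ,
      IsSpectralSolution (graphLaplacian (H m)) Y →
      ∀ k j, |(1 / (n m k : ℝ)) * ∑ i, √(n m k : ℝ) * Y ⟨k, i⟩ j| ≤ ε := by
  have hτ : 0 < ρ k₀ / 2 * (p - pin k₀) := mul_pos (half_pos (hρ0 k₀)) (sub_pos.2 hp)
  set τ := ρ k₀ / 2 * (p - pin k₀) with hτdef
  -- The bound obtained is on the squared centroid, hence `ε ^ 2`; eventually `-τ` bounds the
  -- smallest coefficient from above.
  filter_upwards [hH (τ * ε ^ 2 / (2 * r + 1)) (by positivity), eventually_sizes_ge hn (r + 1),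
    eventually_fraction_gt_half hρ0 hρ k₀] with m h1 h2 h3 Y hY k j
  have hθ : minExcess (n m) pin p ≤ -τ := by
    refine (minExcess_le (n m) pin p k₀).trans ?_
    have := mul_le_mul_of_nonneg_right h3.le (sub_pos.2 hp).le
    linarith
  have h4 := sq_clusterSum_solution_le hK h2 h1 hτ.le hθ hY k j
  have h5 : τ * ((∑ i, Y ⟨k, i⟩ j) ^ 2 / n m k) ≤ τ * ε ^ 2 := by
    refine h4.trans ?_
    rw [mul_div_assoc', div_le_iff₀ (by positivity)]
    nlinarith [mul_pos hτ (pow_pos hε 2)]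
  have h6 := le_of_mul_le_mul_left h5 hτ
  rw [mean_eq (fun i => Y ⟨k, i⟩ j)]
  refine abs_le_of_sq_le_sq ?_ hε.le
  rw [div_pow, Real.sq_sqrt (Nat.cast_nonneg _)]
  exact h6

/-- The columns of a spectral solution cannot be at the same time almost constant and almost
centred on every cluster. -/
lemma not_coherent_and_incoherent {N : Fin K → ℕ} (hK : 0 < K) (hN : ∀ k, 0 < N k) (hr : 0 < r)
    {Y : Matrix (ClusterNode N) (Fin r) ℝ} (hY : Y ∈ spectralFeasible (ClusterNode N) r)
    (hcoh : ∀ k, ∃ v : Fin r → ℝ, ∀ j,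
      (1 / (N k : ℝ)) * ∑ i, (√(N k : ℝ) * Y ⟨k, i⟩ j - v j) ^ 2 ≤ 1 / (4 * K))
    (hinc : ∀ k j, |(1 / (N k : ℝ)) * ∑ i, √(N k : ℝ) * Y ⟨k, i⟩ j| ≤ 1 / (4 * K)) : False := by
  have hKR : (1 : ℝ) ≤ K := by exact_mod_cast hK
  -- On each cluster the second moment is at most `1/(4K) + (1/(4K))² ≤ 2/(4K)`, so the column has
  -- total squared norm at most `1/2` instead of 1.
  have hbound : ∀ k, ∑ i, Y ⟨k, i⟩ ⟨0, hr⟩ ^ 2 ≤ 2 * (1 / (4 * (K : ℝ))) := by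
    intro k
    obtain ⟨v, hv⟩ := hcoh k
    have h1 := hv ⟨0, hr⟩
    rw [mean_sq_sub_eq (hN k) (fun i => Y ⟨k, i⟩ ⟨0, hr⟩)] at h1
    have h2 := hinc k ⟨0, hr⟩
    rw [mean_eq (fun i => Y ⟨k, i⟩ ⟨0, hr⟩)] at h2
    have h3 : (∑ i, Y ⟨k, i⟩ ⟨0, hr⟩) ^ 2 / (N k : ℝ)
        = |(∑ i, Y ⟨k, i⟩ ⟨0, hr⟩) / √(N k : ℝ)| ^ 2 := by
      rw [sq_abs, div_pow, Real.sq_sqrt (Nat.cast_nonneg _)]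
    have h4 : 1 / (4 * (K : ℝ)) ≤ 1 := by
      rw [div_le_one (by positivity)]
      linarith
    have h5 : |(∑ i, Y ⟨k, i⟩ ⟨0, hr⟩) / √(N k : ℝ)| ^ 2 ≤ 1 / (4 * (K : ℝ)) := by
      nlinarith [abs_nonneg ((∑ i, Y ⟨k, i⟩ ⟨0, hr⟩) / √(N k : ℝ))]
    have h6 := sq_nonneg (v ⟨0, hr⟩ - (∑ i, Y ⟨k, i⟩ ⟨0, hr⟩) / √(N k : ℝ))
    linarith
  have h1 := sum_sq_of_feasible hY ⟨0, hr⟩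
  rw [Fintype.sum_sigma] at h1
  have h2 := Finset.sum_le_sum fun k (_ : k ∈ Finset.univ) => hbound k
  rw [h1, Finset.sum_const, Finset.card_univ, Fintype.card_fin, nsmul_eq_mul] at h2
  have h3 : (K : ℝ) * (2 * (1 / (4 * (K : ℝ)))) = 1 / 2 := by
    field_simp
    norm_num
  linarith

end Limits

/-! ### Existence and uniqueness of the critical value. -/

section CriticalValue

variable {K : ℕ} {n : ℕ → Fin K → ℕ} {ρ : Fin K → ℝ} {pin : Fin K → ℝ}
  {Ω : ℝ → Type*} [∀ p, MeasurableSpace (Ω p)] {μ : ∀ p, Measure (Ω p)}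
  [∀ p, IsProbabilityMeasure (μ p)]
  {G : ∀ (p : ℝ) (N : Fin K → ℕ), Ω p → SimpleGraph (ClusterNode N)}

/-- Two different critical values would make the solutions both coherent and incoherent for the
edge probabilities between them. -/
lemma IsCriticalValue.not_lt (hK : 2 ≤ K) (hn : ∀ k, Tendsto (fun m => n m k) atTop atTop)
    {q q' : ℝ} (hq : IsCriticalValue μ G n ρ q) (hq' : IsCriticalValue μ G n ρ q') : ¬ q < q' := by
  intro hlt
  obtain ⟨p, hp, hp'⟩ := exists_between hlt
  have hpI : p ∈ Set.Icc (0 : ℝ) 1 := ⟨hq.mem_Icc.1.trans hp.le, hp'.le.trans hq'.mem_Icc.2⟩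
  obtain ⟨ω, hω, hω'⟩ :=
    ((hq.incoherent_of_gt p hpI hp).and (hq'.coherent_of_lt p hpI hp')).exists
  have hKR : (0 : ℝ) < K := by exact_mod_cast (by omega : 0 < K)
  obtain ⟨m, ⟨h1, h2⟩, h3⟩ :=
    (((hω (1 / (4 * K)) (by positivity)).and (hω' (1 / (4 * K)) (by positivity))).and
      (eventually_sizes_ge hn 1)).exists
  have hcard : K - 1 + 1 ≤ Fintype.card (ClusterNode (n m)) := by
    rw [Fintype.card_sigma]
    calc K - 1 + 1 = ∑ _k : Fin K, 1 := by simp; omega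
      _ ≤ ∑ k, Fintype.card (Fin (n m k)) := Finset.sum_le_sum fun k _ => by simpa using h3 k
  obtain ⟨Y, hY⟩ := exists_isSpectralSolution (spectralFeasible_nonempty hcard)
    (graphLaplacian (G p (n m) ω))
  exact not_coherent_and_incoherent (by omega) h3 (by omega) hY.1 (h2 Y hY) (h1 Y hY)

lemma isCriticalValue_iInf (hK : 2 ≤ K) (hn : ∀ k, Tendsto (fun m => n m k) atTop atTop)
    (hρ0 : ∀ k, 0 < ρ k)
    (hρ : ∀ k, Tendsto (fun m => (n m k : ℝ) / ∑ l, (n m l : ℝ)) atTop (𝓝 (ρ k)))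
    (hpin : ∀ k, pin k ∈ Set.Icc (0 : ℝ) 1)
    (hG : ∀ p ∈ Set.Icc (0 : ℝ) 1, ∀ N : Fin K → ℕ, IsSBM (μ p) N pin p (G p N)) :
    IsCriticalValue μ G n ρ (⨅ k, pin k) := by
  have hK0 : 0 < K := by omega
  have hK1 : K - 1 + 1 ≤ K := by omega
  have hcast : ((K - 1 : ℕ) : ℝ) = (K : ℝ) - 1 := by
    rw [Nat.cast_sub (by omega), Nat.cast_one]
  have hr : (0 : ℝ) ≤ (K : ℝ) - 1 := by rw [← hcast]; positivity
  have : Nonempty (Fin K) := ⟨⟨0, hK0⟩⟩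
  have hmin : ∀ k, (⨅ k, pin k) ≤ pin k := fun k => ciInf_le (Set.finite_range _).bddBelow k
  obtain ⟨k₀, hk₀⟩ := exists_eq_ciInf_of_finite (f := pin)
  have hnear : ∀ p ∈ Set.Icc (0 : ℝ) 1, ∀ᵐ ω ∂(μ p), ∀ δ : ℝ, 0 < δ → ∀ᶠ m in atTop,
      IsNearBlock (G p (n m) ω) pin p δ := fun p hp =>
    IsSBM.ae_eventually_isNearBlock hK0 hn (fun k => (hpin k).1) hp.1 (hG p hp)
  refine ⟨⟨Real.iInf_nonneg fun k => (hpin k).1, hk₀ ▸ (hpin k₀).2⟩, fun p hp hpq => ?_,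
    ⟨((K : ℝ) - 1) * ⨅ k, ρ k * pin k, fun p hp => ?_, fun p hp hpq => ?_⟩,
    fun p hp hpq => ?_, fun p hp hpq => ?_⟩
  · filter_upwards [hnear p hp] with ω hω
    have h := tendsto_partialEigSum_div (H := fun m => G p (n m) ω) hK1 hn hρ hω
    have hnn : 0 ≤ ⨅ k, ρ k * (pin k - p) :=
      Real.iInf_nonneg fun k => mul_nonneg (hρ0 k).le (sub_nonneg.2 (hpq.trans (hmin k)))
    rwa [min_eq_left hnn, add_zero, hcast] at h
  · have hcl := ae_all_iff.2 fun k =>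
      IsSBM.ae_eventually_cluster hK0 hn (fun k => (hpin k).1) (hG p hp) k
    filter_upwards [hcl] with ω hω
    have h := tendsto_iInf_partialEigSum_div (H := fun m => G p (n m) ω) (r := K - 1) hK0 hn hρ hω
    rwa [hcast] at h
  · filter_upwards [hnear p hp] with ω hω ε hε
    have h := tendsto_partialEigSum_div (H := fun m => G p (n m) ω) hK1 hn hρ hω
    have hle : ∀ k, (⨅ k, ρ k * (pin k - p)) ≤ ρ k * (pin k - p) := fun k =>
      ciInf_le (Set.finite_range _).bddBelow k
    have hnp : (⨅ k, ρ k * (pin k - p)) ≤ 0 :=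
      (hle k₀).trans (mul_nonpos_of_nonneg_of_nonpos (hρ0 k₀).le (by linarith))
    rw [min_eq_right hnp, hcast] at h
    obtain ⟨k₁, hk₁⟩ := exists_eq_ciInf_of_finite (f := fun k => ρ k * (pin k - p))
    obtain ⟨k₂, hk₂⟩ := exists_eq_ciInf_of_finite (f := fun k => ρ k * pin k)
    have hprod : (⨅ k, ρ k * pin k) ≤ ρ k₁ * pin k₁ := ciInf_le (Set.finite_range _).bddBelow k₁
    have hsup : ρ k₁ ≤ ⨆ k, ρ k := le_ciSup (Set.finite_range _).bddAbove k₁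
    have hinf : (⨅ k, ρ k) ≤ ρ k₂ := ciInf_le (Set.finite_range _).bddBelow k₂
    -- Up to the factor `K - 1`, the limit is `p + ⨅ k, ρ k * (pin k - p)`. Evaluating at its own
    -- minimizer `k₁` gives the lower bound, and evaluating at the minimizer `k₂` of `ρ k * pin k`
    -- gives the upper one.
    have hlow : (⨅ k, ρ k * pin k) + (1 - ⨆ k, ρ k) * p ≤ p + ⨅ k, ρ k * (pin k - p) := by
      rw [← hk₁]
      nlinarith [mul_le_mul_of_nonneg_right hsup hp.1]
    have hupp : p + (⨅ k, ρ k * (pin k - p)) ≤ (⨅ k, ρ k * pin k) + (1 - ⨅ k, ρ k) * p := by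
      rw [← hk₂]
      nlinarith [mul_le_mul_of_nonneg_right hinf hp.1, hle k₂]
    have hlow' := mul_le_mul_of_nonneg_left hlow hr
    have hupp' := mul_le_mul_of_nonneg_left hupp hr
    filter_upwards [h.eventually (Ioo_mem_nhds (sub_lt_self _ hε) (lt_add_of_pos_right _ hε))]
      with m hm
    constructor
    · linarith [hm.1]
    · linarith [hm.2]
  · filter_upwards [hnear p hp] with ω hω ε hε
    exact eventually_coherent (H := fun m => G p (n m) ω) hK1 hn hρ0 hρ
      (fun k => hpq.trans_le (hmin k)) hω hε
  · filter_upwards [hnear p hp] with ω hω ε hε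
    exact eventually_incoherent (H := fun m => G p (n m) ω) hK1 hn hρ0 hρ
      (k₀ := k₀) (by rwa [hk₀]) hω hε

end CriticalValue

theorem mainTheorem10 {K : ℕ} (hK : 2 ≤ K)
    (n : ℕ → Fin K → ℕ) (hn : ∀ k, Tendsto (fun m => n m k) atTop atTop)
    (ρ : Fin K → ℝ)
    (hρ : ∀ k, Tendsto (fun m => (n m k : ℝ) / ∑ l, (n m l : ℝ)) atTop (𝓝 (ρ k)))
    (c : ℝ) (hc : 0 < c)
    (hnc : Tendsto (fun m => (⨅ k, (n m k : ℝ)) / ⨆ k, (n m k : ℝ)) atTop (𝓝 c))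
    (pin : Fin K → ℝ) (hpin : ∀ k, pin k ∈ Set.Icc (0 : ℝ) 1)
    {Ω : ℝ → Type*} [∀ p, MeasurableSpace (Ω p)] (μ : ∀ p, Measure (Ω p))
    [∀ p, IsProbabilityMeasure (μ p)]
    (G : ∀ (p : ℝ) (N : Fin K → ℕ), Ω p → SimpleGraph (ClusterNode N))
    (hG : ∀ p ∈ Set.Icc (0 : ℝ) 1, ∀ N : Fin K → ℕ, IsSBM (μ p) N pin p (G p N)) :
    (∃! pStar : ℝ, IsCriticalValue μ G n ρ pStar) ∧
      ∀ pStar : ℝ, IsCriticalValue μ G n ρ pStar →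
        c * (⨅ k, pin k) ≤ pStar ∧ pStar ≤ (1 / c) * ⨅ k, pin k := by
  have hK0 : 0 < K := by omega
  have hcrit := isCriticalValue_iInf hK hn (limit_fraction_pos hρ hc hnc hK0 hn) hρ hpin hG
  -- `⨅ k, pin k` is itself a critical value, so incomparability of distinct critical values pins
  -- down every other candidate.
  have huniq : ∀ q, IsCriticalValue μ G n ρ q → q = ⨅ k, pin k := fun q hq =>
    le_antisymm (not_lt.1 (hcrit.not_lt hK hn hq)) (not_lt.1 (hq.not_lt hK hn hcrit))
  refine ⟨⟨_, hcrit, huniq⟩, fun q hq => ?_⟩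
  have h0 : 0 ≤ ⨅ k, pin k := Real.iInf_nonneg fun k => (hpin k).1
  have hc1 := limit_ratio_le_one hnc hK0
  rw [huniq q hq]
  exact ⟨mul_le_of_le_one_left h0 hc1, le_mul_of_one_le_left h0 ((one_le_div hc).2 hc1)⟩
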